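/- Let $(M,\Pi)$ be a Poisson manifold, i.e. a smooth (Hausdorff, second countable) manifold of dimension $m$ with a smooth bivector field $\Pi$ whose bracket $\{f,g\}=\Pi(\mathrm{d}f,\mathrm{d}g)$ satisfies the Jacobi identity (the bracket is extended complex-bilinearly to complex-valued functions). For $g\in C^\infty(M)$ real-valued let $X_g$ be the Hamiltonian vector field determined by $X_g(f)=\{f,g\}$. Let $X$ be a smooth vector field on $M$, let $\beta>0$, and let $\varphi\colon C^\infty_c(M)\to\mathbb{C}$ be an $(X,\beta)$-KMS functional: a linear functional on the space of complex-valued compactly supported smooth functions which is positive ($\varphi(f)\ge 0$ if $f\ge 0$) and satisfies $$\varphi(\{f,g\})=\beta\,\varphi(g\,X(f))\qquad\text{for all } f,g\in C^\infty_c(M).$$ Then the following hold. 1. $\varphi$ is invariant under the flow $\Psi^X$ of $X$: for every $t\in\mathbb{R}$ and every $f\in C_c^\infty(M)$ whose support is contained in the domain of $\Psi^X_{-t}$, the function $f\circ\Psi^X_t$, extended by $0$ outside the domain of $\Psi^X_t$, lies in $C_c^\infty(M)$ and $$\varphi(f\circ\Psi^X_t)=\varphi(f).$$ In particular, if $X$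 is complete, this holds for all $t\in\mathbb{R}$ and $f\in C_c^\infty(M)$. 2. For every real-valued $g\in C^\infty(M)$ whose Hamiltonian vector field $X_g$ is complete, with flow $\Psi^g$, and for all $f\in C_c^\infty(M)$ and $t\in\mathbb{R}$, the function $\exp\big(\beta\int_0^t(\Psi^g_s)^*X(g)\,\mathrm{d}s\big)(\Psi^g_t)^*f$ lies in $C^\infty_c(M)$ and $$\varphi(f)=\varphi\Big(\exp\Big(\beta\int_0^t(\Psi^g_s)^*X(g)\,\mathrm{d}s\Big)(\Psi^g_t)^*f\Big).$$ 3. Let $\operatorname{supp}(\varphi)$ be the set of $x\in M$ such that for every open neighbourhood $U$ of $x$ there is a non-negative $f\in C_c^\infty(U)$ with $\varphi(f)>0$, and let $L_x$ be the symplectic leaf through $x$, i.e. the set of points that can be joined to $x$ by a piecewise smooth curve each segment of which is a trajectory of a locally defined Hamiltonian vector field. If $M$ is compact, then $x\in\operatorname{supp}(\varphi)$ implies $L_x\subseteq\operatorname{supp}(\varphi)$; in particular $$\operatorname{supp}(\varphi)=\bigcup_{x\in\operatorname{supp}(\varphi)}L_x.$$ -/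

import Mathlib

open scoped Manifold ContDiff ComplexOrder

noncomputable section

namespace KMS

/-- Smooth real vector fields on an `m`-dimensional manifold `M`. -/
abbrev VectorField (m : ℕ) (M : Type*) [TopologicalSpace M]
    [ChartedSpace (EuclideanSpace ℝ (Fin m)) M]
    [IsManifold (𝓡 m) ∞ M] : Type _ :=
  ContMDiffSection (𝓡 m) (EuclideanSpace ℝ (Fin m)) ∞ (fun x : M ↦ TangentSpace (𝓡 m) x)

section Basic

variable {m : ℕ} {M : Type*} [TopologicalSpace M] [ChartedSpace (EuclideanSpace ℝ (Fin m)) M]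

/-- The differential `dg` of a real function at `x`, as an element of the cotangent space. -/
def differential (g : M → ℝ) (x : M) : Module.Dual ℝ (TangentSpace (𝓡 m) x) :=
  (mvfderiv (𝓡 m) g x).toLinearMap

instance (x : M) : FiniteDimensional ℝ (TangentSpace (𝓡 m) x) :=
  inferInstanceAs (FiniteDimensional ℝ (EuclideanSpace ℝ (Fin m)))

/-- The derivative `Y(f)` of a real or complex function `f` along a vector field `Y`. -/
def derivAlong {F : Type*} [NormedAddCommGroup F] [NormedSpace ℝ F]
    (Y : (x : M) → TangentSpace (𝓡 m) x) (f : M → F) (x : M) : F :=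
  mvfderiv (𝓡 m) f x (Y x)

end Basic

/-- A Poisson structure: a smooth bivector field `Π` (a skew form on each cotangent space,
`Π(df, dg)` being smooth for smooth `f, g`), whose bracket `{f, g} = Π(df, dg)` satisfies the
Jacobi identity. -/
structure PoissonStructure (m : ℕ) (M : Type*) [TopologicalSpace M]
    [ChartedSpace (EuclideanSpace ℝ (Fin m)) M] where
  tensor : (x : M) → Module.Dual ℝ (TangentSpace (𝓡 m) x) →ₗ[ℝ]
    Module.Dual ℝ (TangentSpace (𝓡 m) x) →ₗ[ℝ] ℝ
  alternating : ∀ (x : M) (α : Module.Dual ℝ (TangentSpace (𝓡 m) x)), tensor x α α = 0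
  smooth : ∀ f g : M → ℝ, ContMDiff (𝓡 m) 𝓘(ℝ, ℝ) ∞ f → ContMDiff (𝓡 m) 𝓘(ℝ, ℝ) ∞ g →
    ContMDiff (𝓡 m) 𝓘(ℝ, ℝ) ∞ (fun x ↦ tensor x (differential f x) (differential g x))
  jacobi : ∀ f g h : M → ℝ, ContMDiff (𝓡 m) 𝓘(ℝ, ℝ) ∞ f → ContMDiff (𝓡 m) 𝓘(ℝ, ℝ) ∞ g →
    ContMDiff (𝓡 m) 𝓘(ℝ, ℝ) ∞ h → ∀ x : M,
      tensor x (differential f x)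
          (differential (fun y ↦ tensor y (differential g y) (differential h y)) x) +
        tensor x (differential g x)
          (differential (fun y ↦ tensor y (differential h y) (differential f y)) x) +
        tensor x (differential h x)
          (differential (fun y ↦ tensor y (differential f y) (differential g y)) x) = 0

section

variable {m : ℕ} {M : Type*} [TopologicalSpace M] [ChartedSpace (EuclideanSpace ℝ (Fin m)) M]

namespace PoissonStructure

/-- The Poisson bracket `{f, g} = Π(df, dg)` of real functions. -/
def bracket (P : PoissonStructure m M) (f g : M → ℝ) (x : M) : ℝ :=
  P.tensor x (differential f x) (differential g x)

/-- The complex-bilinear extension of the Poisson bracket to complex functions. -/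
def bracketC (P : PoissonStructure m M) (f g : M → ℂ) (x : M) : ℂ :=
  ((P.bracket (fun y ↦ (f y).re) (fun y ↦ (g y).re) x -
      P.bracket (fun y ↦ (f y).im) (fun y ↦ (g y).im) x : ℝ) : ℂ) +
    ((P.bracket (fun y ↦ (f y).re) (fun y ↦ (g y).im) x +
      P.bracket (fun y ↦ (f y).im) (fun y ↦ (g y).re) x : ℝ) : ℂ) * Complex.I

/-- The anchor `♯ : T*M → TM`, characterised by `ξ(♯α) = Π(ξ, α)` for all covectors `ξ`. -/
def sharp (P : PoissonStructure m M) (x : M) (α : Module.Dual ℝ (TangentSpace (𝓡 m) x)) :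
    TangentSpace (𝓡 m) x :=
  (Module.evalEquiv ℝ (TangentSpace (𝓡 m) x)).symm ((P.tensor x).flip α)

/-- The Hamiltonian vector field `X_g = ♯dg`, so that `X_g(f) = {f, g}`. -/
def hamiltonianVF (P : PoissonStructure m M) (g : M → ℝ) (x : M) : TangentSpace (𝓡 m) x :=
  P.sharp x (differential g x)

theorem apply_sharp (P : PoissonStructure m M) (x : M)
    (ξ α : Module.Dual ℝ (TangentSpace (𝓡 m) x)) : ξ (P.sharp x α) = P.tensor x ξ α := by
  simp [sharp]

theorem derivAlong_hamiltonianVF (P : PoissonStructure m M) (f g : M → ℝ) (x : M) :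
    derivAlong (P.hamiltonianVF g) f x = P.bracket f g x :=
  P.apply_sharp x (differential f x) (differential g x)

end PoissonStructure

/-- `Y` has an integral curve going from `x` at time `0` to `y` at time `t` (`t` may be negative);
that is, `x` is in the domain of the (maximal) time-`t` flow map of `Y`, which sends `x` to `y`. -/
def FlowsTo (Y : (x : M) → TangentSpace (𝓡 m) x) (t : ℝ) (x y : M) : Prop :=
  ∃ γ : ℝ → M, IsMIntegralCurveOn γ Y (Set.uIcc 0 t) ∧ γ 0 = x ∧ γ t = y

/-- The domain of the time-`t` flow map of `Y`. -/
def flowDomain (Y : (x : M) → TangentSpace (𝓡 m) x) (t : ℝ) : Set M :=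
  {x | ∃ y, FlowsTo Y t x y}

open Classical in
/-- The pull-back of `f` along the time-`t` flow map of a possibly incomplete vector field `Y`,
extended by zero outside the domain of that map. -/
def flowPullback (Y : (x : M) → TangentSpace (𝓡 m) x) (t : ℝ) (f : M → ℂ) (x : M) : ℂ :=
  if h : ∃ y, FlowsTo Y t x y then f h.choose else 0

/-- `Ψ` is the flow of the vector field `Y`, all of whose integral curves exist for all times
(that is, `Y` is complete). -/
def IsGlobalFlow (Y : (x : M) → TangentSpace (𝓡 m) x) (Ψ : ℝ → M → M) : Prop :=
  ∀ x, Ψ 0 x = x ∧ IsMIntegralCurve (fun t ↦ Ψ t x) Y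

/-- `y` is reached from `x` along a trajectory of a locally defined Hamiltonian vector field. -/
def HamiltonianStep (P : PoissonStructure m M) (x y : M) : Prop :=
  ∃ (U : Set M) (g : M → ℝ) (γ : ℝ → M) (t : ℝ), IsOpen U ∧ ContMDiffOn (𝓡 m) 𝓘(ℝ, ℝ) ∞ g U ∧
    (∀ s ∈ Set.uIcc 0 t, γ s ∈ U) ∧ IsMIntegralCurveOn γ (P.hamiltonianVF g) (Set.uIcc 0 t) ∧
    γ 0 = x ∧ γ t = y

/-- The symplectic leaf through `x`: all points joined to `x` by a piecewise smooth curve each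
segment of which is a trajectory of a locally defined Hamiltonian vector field. -/
def symplecticLeaf (P : PoissonStructure m M) (x : M) : Set M :=
  {y | Relation.ReflTransGen (HamiltonianStep P) x y}

theorem contMDiff_mulC {f g : M → ℂ} (hf : ContMDiff (𝓡 m) 𝓘(ℝ, ℂ) ∞ f)
    (hg : ContMDiff (𝓡 m) 𝓘(ℝ, ℂ) ∞ g) : ContMDiff (𝓡 m) 𝓘(ℝ, ℂ) ∞ (fun x ↦ f x * g x) :=
  (contDiff_mul (𝕜 := ℝ) (𝔸 := ℂ) (n := ∞)).contMDiff.comp (hf.prodMk_space hg)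

/-- The space `C_c^∞(M)` of complex-valued compactly supported smooth functions. -/
def testFunctions (m : ℕ) (M : Type*) [TopologicalSpace M]
    [ChartedSpace (EuclideanSpace ℝ (Fin m)) M] : Submodule ℂ (M → ℂ) where
  carrier := {f | ContMDiff (𝓡 m) 𝓘(ℝ, ℂ) ∞ f ∧ HasCompactSupport f}
  add_mem' hf hg := ⟨hf.1.add hg.1, hf.2.add hg.2⟩
  zero_mem' := ⟨contMDiff_const, HasCompactSupport.zero⟩
  smul_mem' _ _ hf := ⟨contMDiff_mulC contMDiff_const hf.1, hf.2.mul_left⟩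

theorem mvfderiv_eq_zero_of_notMem {F : Type*} [NormedAddCommGroup F] [NormedSpace ℝ F]
    {f : M → ℂ} {x : M} (hx : x ∉ tsupport f) (L : ℂ →L[ℝ] F) :
    mvfderiv (𝓡 m) (fun y ↦ L (f y)) x = 0 := by
  have h : (fun y ↦ L (f y)) =ᶠ[nhds x] fun _ ↦ (0 : F) := by
    filter_upwards [notMem_tsupport_iff_eventuallyEq.mp hx] with y hy
    simp [hy]
  unfold mvfderiv
  rw [h.mfderiv_eq, mfderiv_const]
  exact ContinuousLinearMap.comp_zero _

theorem bracketC_mem (P : PoissonStructure m M) {f g : M → ℂ} (hf : f ∈ testFunctions m M)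
    (hg : g ∈ testFunctions m M) : P.bracketC f g ∈ testFunctions m M := by
  have re : ∀ {h : M → ℂ}, ContMDiff (𝓡 m) 𝓘(ℝ, ℂ) ∞ h →
      ContMDiff (𝓡 m) 𝓘(ℝ, ℝ) ∞ (fun x ↦ (h x).re) := fun hh ↦
    Complex.reCLM.contDiff.contMDiff.comp hh
  have im : ∀ {h : M → ℂ}, ContMDiff (𝓡 m) 𝓘(ℝ, ℂ) ∞ h →
      ContMDiff (𝓡 m) 𝓘(ℝ, ℝ) ∞ (fun x ↦ (h x).im) := fun hh ↦
    Complex.imCLM.contDiff.contMDiff.comp hh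
  have ofR : ∀ {h : M → ℝ}, ContMDiff (𝓡 m) 𝓘(ℝ, ℝ) ∞ h →
      ContMDiff (𝓡 m) 𝓘(ℝ, ℂ) ∞ (fun x ↦ (h x : ℂ)) := fun hh ↦
    Complex.ofRealCLM.contDiff.contMDiff.comp hh
  refine ⟨?_, hf.2.mono' ?_⟩
  · exact (ofR ((P.smooth _ _ (re hf.1) (re hg.1)).sub (P.smooth _ _ (im hf.1) (im hg.1)))).add
      (contMDiff_mulC (ofR ((P.smooth _ _ (re hf.1) (im hg.1)).add
        (P.smooth _ _ (im hf.1) (re hg.1)))) contMDiff_const)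
  · intro x hx
    by_contra hxf
    apply hx
    have h1 : differential (m := m) (fun y ↦ (f y).re) x = 0 := by
      have := mvfderiv_eq_zero_of_notMem (m := m) hxf Complex.reCLM
      simp only [Complex.reCLM_apply] at this
      simp [differential, this]
    have h2 : differential (m := m) (fun y ↦ (f y).im) x = 0 := by
      have := mvfderiv_eq_zero_of_notMem (m := m) hxf Complex.imCLM
      simp only [Complex.imCLM_apply] at this
      simp [differential, this]
    simp [PoissonStructure.bracketC, PoissonStructure.bracket, h1, h2]

theorem contMDiff_derivAlong [IsManifold (𝓡 m) ∞ M] {F : Type*} [NormedAddCommGroup F]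
    [NormedSpace ℝ F] (X : VectorField m M) {f : M → F} (hf : ContMDiff (𝓡 m) 𝓘(ℝ, F) ∞ f) :
    ContMDiff (𝓡 m) 𝓘(ℝ, F) ∞ (derivAlong X f) := by
  have h1 := (hf.contMDiff_tangentMap (m := ∞) (by simp)).comp X.contMDiff
  intro x
  have h2 := (Bundle.contMDiffAt_totalSpace.mp (h1 x)).2
  simpa [derivAlong, mvfderiv, tangentMap, Function.comp_def] using! h2

theorem mul_derivAlong_mem [IsManifold (𝓡 m) ∞ M] (X : VectorField m M) {f g : M → ℂ}
    (hf : f ∈ testFunctions m M) (hg : g ∈ testFunctions m M) :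
    (fun x ↦ g x * derivAlong X f x) ∈ testFunctions m M :=
  ⟨contMDiff_mulC hg.1 (contMDiff_derivAlong X hf.1), hg.2.mul_right⟩

/-- `φ` is an `(X, β)`-KMS functional: a linear functional on `C_c^∞(M)` which is positive and
satisfies `φ({f, g}) = β φ(g X(f))` for all `f, g ∈ C_c^∞(M)`. -/
structure IsKMSFunctional [IsManifold (𝓡 m) ∞ M] (P : PoissonStructure m M)
    (X : VectorField m M) (β : ℝ) (φ : testFunctions m M →ₗ[ℂ] ℂ) : Prop where
  positive : ∀ f : testFunctions m M, (∀ x, 0 ≤ (f : M → ℂ) x) → 0 ≤ φ f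
  kms : ∀ f g : testFunctions m M,
    φ ⟨P.bracketC f g, bracketC_mem P f.2 g.2⟩ =
      β * φ ⟨fun x ↦ (g : M → ℂ) x * derivAlong X (f : M → ℂ) x, mul_derivAlong_mem X f.2 g.2⟩

/-- The support of a positive functional on `C_c^∞(M)`. -/
def funSupport (φ : testFunctions m M →ₗ[ℂ] ℂ) : Set M :=
  {x | ∀ U : Set M, IsOpen U → x ∈ U → ∃ f : testFunctions m M,
    tsupport (f : M → ℂ) ⊆ U ∧ (∀ y, 0 ≤ (f : M → ℂ) y) ∧ 0 < φ f}

end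

end KMS

end

/-! All three statements come from one fact about a smooth field `V` and a smooth real weight `w`.
Put `A f = V f + w f` (`generator`). A positive functional that vanishes on the image of `A` is
preserved when `f` is pulled back along the flow of `V` and multiplied by the exponential of the
integral of `w` along trajectories (`exists_transport`). The KMS condition supplies two such pairs.
Inserting a `g` equal to 1 near the support of `f` gives `φ(X f) = 0`, the pair `(X, 0)`. The
Leibniz identity `X_g f + β X(g) f = {f, g} - β g X(f) + β X(g f)` then gives the pair `(X_g, β
X(g))`. Since exponentials are positive, the second transport carries non-negative test functions
with `φ > 0` along Hamiltonian trajectories, so the support is a union of leaves.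

Formally, if `u_t` is the transported function, then `d/dt φ(u_t) = φ(A u_t) = 0`. Differentiation
under `φ` is replaced by an estimate. Positivity bounds `φ` by the sup norm on functions vanishing
off a fixed compact set (`IsPositive.exists_bound`). Second-order Taylor expansion in time, uniform
in the point, together with `φ(A u_s) = 0` then gives `|φ(u_r) - φ(u_s)| ≤ C |r - s|²`, so `φ(u_t)`
is constant (`FlowBox.extendFun_push`).

This is done for short times in flow boxes, chained along a compact trajectory
(`transportsNear_of_flowsTo`) and summed with a partition of unity. Smooth dependence of the flow on
the initial point is obtained by inverting `γ ↦ γ - ∫ V ∘ γ` on a Banach space of paths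
(`exists_contDiff_solution`). -/

noncomputable section

open scoped Topology
open Set Filter MeasureTheory

set_option linter.unusedSectionVars false

namespace KMS

/-! ### Smoothness of the superposition operator on spaces of continuous paths -/

section Superposition

variable {I : Type*} [TopologicalSpace I] [CompactSpace I]
  {E : Type} [NormedAddCommGroup E] [NormedSpace ℝ E]
  {F : Type} [NormedAddCommGroup F] [NormedSpace ℝ F]

/-- Pointwise application of a continuous family of operators, as a bounded bilinear map. -/
def pointwiseApply (I E F : Type*) [TopologicalSpace I] [CompactSpace I] [NormedAddCommGroup E]
    [NormedSpace ℝ E] [NormedAddCommGroup F] [NormedSpace ℝ F] :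
    C(I, E →L[ℝ] F) →L[ℝ] C(I, E) →L[ℝ] C(I, F) :=
  LinearMap.mkContinuous₂
    (LinearMap.mk₂ ℝ
      (fun (A : C(I, E →L[ℝ] F)) (h : C(I, E)) ↦
        (⟨fun s ↦ A s (h s), A.continuous.clm_apply h.continuous⟩ : C(I, F)))
      (fun _ _ _ ↦ by ext; simp) (fun _ _ _ ↦ by ext; simp)
      (fun _ _ _ ↦ by ext; simp) (fun _ _ _ ↦ by ext; simp)) 1
    (fun A h ↦ by
      rw [one_mul, ContinuousMap.norm_le _ (by positivity)]
      intro s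
      exact ((A s).le_opNorm (h s)).trans
        (mul_le_mul (A.norm_coe_le_norm s) (h.norm_coe_le_norm s) (norm_nonneg _) (norm_nonneg A)))

theorem norm_pointwiseApply_le (A : C(I, E →L[ℝ] F)) : ‖pointwiseApply I E F A‖ ≤ ‖A‖ := by
  refine ContinuousLinearMap.opNorm_le_bound _ (norm_nonneg A) fun h ↦ ?_
  rw [ContinuousMap.norm_le _ (by positivity)]
  intro s
  exact ((A s).le_opNorm (h s)).trans
    (mul_le_mul (A.norm_coe_le_norm s) (h.norm_coe_le_norm s) (norm_nonneg _) (norm_nonneg A))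

/-- On the segment from `x` to `y` the derivative differs from its value at `x` by at most `C * ‖y -
x‖`; the mean value inequality does the rest. -/
theorem norm_taylor_le_of_lipschitz_fderiv {V : E → F} (hV : Differentiable ℝ V) {C : NNReal}
    (hC : LipschitzWith C (fderiv ℝ V)) (x y : E) :
    ‖V y - V x - fderiv ℝ V x (y - x)‖ ≤ C * ‖y - x‖ * ‖y - x‖ := by
  refine (convex_segment x y).norm_image_sub_le_of_norm_fderiv_le' (𝕜 := ℝ)
    (fun z _ ↦ hV z) (fun z hz ↦ ?_) (left_mem_segment ℝ x y) (right_mem_segment ℝ x y)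
  refine (hC.norm_sub_le z x).trans (mul_le_mul_of_nonneg_left ?_ C.2)
  obtain ⟨a, b, ha, hb, hab, rfl⟩ := hz
  have : a • x + b • y - x = b • (y - x) := by
    rw [← eq_sub_iff_add_eq] at hab
    subst hab
    module
  rw [this, norm_smul, Real.norm_of_nonneg hb]
  exact mul_le_of_le_one_left (norm_nonneg _) (by linarith)

theorem two_le_infty : (2 : WithTop ℕ∞) ≤ ∞ :=
  WithTop.coe_le_coe.2 (le_top : (2 : ℕ∞) ≤ ⊤)

/-- Composition with a continuous map. -/
def superpose {V : E → F} (hV : Continuous V) (γ : C(I, E)) : C(I, F) :=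
  (⟨V, hV⟩ : C(E, F)).comp γ

theorem continuous_superpose {V : E → F} (hV : Continuous V) :
    Continuous (superpose (I := I) hV) :=
  ContinuousMap.continuous_postcomp _

/-- Compact support makes the derivative of `V` globally Lipschitz, so the Taylor error at each time
has the same quadratic constant and the bound passes to the sup norm. -/
theorem hasFDerivAt_superpose {V : E → F} (hV : ContDiff ℝ 2 V) (hc : HasCompactSupport V)
    (γ : C(I, E)) :
    HasFDerivAt (superpose (I := I) hV.continuous)
      (pointwiseApply I E F (superpose (hV.continuous_fderiv (by norm_num)) γ)) γ := by
  obtain ⟨C, hC⟩ := ContDiff.lipschitzWith_of_hasCompactSupport (hc.fderiv (𝕜 := ℝ))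
    (hV.fderiv_right (m := 1) (by norm_num)) one_ne_zero
  refine HasFDerivAt.of_isLittleO ?_
  refine Asymptotics.IsBigO.trans_isLittleO (g := fun γ' ↦ ‖γ' - γ‖ ^ 2) ?_ ?_
  · refine Asymptotics.IsBigO.of_bound C (Eventually.of_forall fun γ' ↦ ?_)
    rw [ContinuousMap.norm_le _ (by positivity)]
    intro s
    refine (norm_taylor_le_of_lipschitz_fderiv (hV.differentiable (by norm_num)) hC
      (γ s) (γ' s)).trans ?_
    have := (γ' - γ).norm_coe_le_norm s
    rw [norm_pow, norm_norm, mul_assoc, ← sq]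
    simp only [ContinuousMap.sub_apply] at this
    gcongr
  · have h1 : Tendsto (fun γ' : C(I, E) ↦ γ' - γ) (𝓝 γ) (𝓝 0) := by
      have : Continuous fun γ' : C(I, E) ↦ γ' - γ := by fun_prop
      simpa using this.tendsto γ
    have h2 : (fun h : C(I, E) ↦ ‖h‖ ^ 2) =o[𝓝 0] fun h ↦ h :=
      Asymptotics.isLittleO_norm_pow_id one_lt_two
    exact h2.comp_tendsto h1

/-- The derivative of superposition by `V` is superposition by `fderiv ℝ V` followed by a bounded
bilinear map. The induction changes the target to `E →L[ℝ] F`, hence the quantifier over `F`. -/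
theorem contDiff_superpose_nat (n : ℕ) : ∀ (F : Type) [NormedAddCommGroup F] [NormedSpace ℝ F]
    {V : E → F} (hV : ContDiff ℝ ∞ V), HasCompactSupport V →
      ContDiff ℝ n (superpose (I := I) hV.continuous) := by
  induction n with
  | zero => exact fun F _ _ V hV _ ↦ contDiff_zero.2 (continuous_superpose _)
  | succ n ih =>
    intro F _ _ V hV hc
    rw [Nat.cast_succ]
    refine contDiff_succ_iff_hasFDerivAt.2 ⟨fun γ ↦ _, ?_, fun γ ↦
      hasFDerivAt_superpose (hV.of_le two_le_infty) hc γ⟩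
    exact (pointwiseApply I E F).contDiff.comp
      (ih (E →L[ℝ] F) (hV.fderiv_right (m := ∞) (by simp)) (hc.fderiv (𝕜 := ℝ)))

/-- The superposition operator of a smooth compactly supported map is smooth. -/
theorem contDiff_superpose {V : E → F} (hV : ContDiff ℝ ∞ V) (hc : HasCompactSupport V) :
    ContDiff ℝ ∞ (superpose (I := I) hV.continuous) :=
  contDiff_infty.2 fun n ↦ contDiff_superpose_nat n F hV hc

end Superposition

/-! ### Short-time smooth flows on a Banach space -/

section Flow

variable {E : Type} [NormedAddCommGroup E] [NormedSpace ℝ E]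

/-- Extension of a continuous path on `[-ε, ε]` to the real line. -/
def extendPath {ε : ℝ} (hε : 0 < ε) (γ : C(Icc (-ε) ε, E)) : ℝ → E :=
  IccExtend (by linarith : -ε ≤ ε) γ

theorem continuous_extendPath {ε : ℝ} (hε : 0 < ε) (γ : C(Icc (-ε) ε, E)) :
    Continuous (extendPath hε γ) := γ.continuous.Icc_extend'

theorem norm_extendPath_le {ε : ℝ} (hε : 0 < ε) (γ : C(Icc (-ε) ε, E)) (t : ℝ) :
    ‖extendPath hε γ t‖ ≤ ‖γ‖ := γ.norm_coe_le_norm _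

/-- The primitive, vanishing at `0`, of a continuous path on `[-ε, ε]`. -/
def primitive {ε : ℝ} (hε : 0 < ε) : C(Icc (-ε) ε, E) →L[ℝ] C(Icc (-ε) ε, E) :=
  LinearMap.mkContinuous
    { toFun := fun γ ↦ ⟨fun t ↦ ∫ s in (0 : ℝ)..t, extendPath hε γ s,
        (intervalIntegral.continuous_primitive
          (fun _ _ ↦ (continuous_extendPath hε γ).intervalIntegrable _ _) 0).comp
          continuous_subtype_val⟩
      map_add' := fun γ γ' ↦ by
        ext t
        exact intervalIntegral.integral_add ((continuous_extendPath hε γ).intervalIntegrable _ _)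
          ((continuous_extendPath hε γ').intervalIntegrable _ _)
      map_smul' := fun c γ ↦ by
        ext t
        exact intervalIntegral.integral_smul c (extendPath hε γ) }
    ε
    (fun γ ↦ by
      rw [ContinuousMap.norm_le _ (by positivity)]
      intro t
      refine (intervalIntegral.norm_integral_le_of_norm_le_const
        (fun s _ ↦ norm_extendPath_le hε γ s)).trans ?_
      rw [mul_comm, sub_zero]
      exact mul_le_mul_of_nonneg_right (abs_le.2 t.2) (norm_nonneg _))

theorem primitive_apply {ε : ℝ} (hε : 0 < ε) (γ : C(Icc (-ε) ε, E)) (t : Icc (-ε) ε) :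
    primitive hε γ t = ∫ s in (0 : ℝ)..t, extendPath hε γ s := rfl

theorem contDiff_primitive {ε : ℝ} (hε : 0 < ε) : ContDiff ℝ ∞ (primitive (E := E) hε) :=
  ContinuousLinearMap.contDiff _

theorem hasFDerivAt_primitive {ε : ℝ} (hε : 0 < ε) (γ : C(Icc (-ε) ε, E)) :
    HasFDerivAt (primitive (E := E) hε) (primitive (E := E) hε) γ :=
  ContinuousLinearMap.hasFDerivAt _

theorem norm_primitive_le {ε : ℝ} (hε : 0 < ε) : ‖primitive (E := E) hε‖ ≤ ε :=
  LinearMap.mkContinuous_norm_le _ hε.le _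

theorem norm_primitive_apply_le {ε : ℝ} (hε : 0 < ε) (γ : C(Icc (-ε) ε, E)) :
    ‖primitive hε γ‖ ≤ ε * ‖γ‖ :=
  (primitive (E := E) hε).le_of_opNorm_le (norm_primitive_le hε) γ

/-- For small `ε`, the map `γ ↦ γ - ∫ V ∘ γ` has a smooth inverse. -/
theorem exists_contDiff_solution [CompleteSpace E] {V : E → E} (hV : ContDiff ℝ ∞ V)
    (hc : HasCompactSupport V) {L : NNReal} (hL : LipschitzWith L V)
    (hL' : ∀ x, ‖fderiv ℝ V x‖ ≤ L) {ε : ℝ} (hε : 0 < ε) (hεL : ε * L < 1) :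
    ∃ S : C(Icc (-ε) ε, E) → C(Icc (-ε) ε, E), ContDiff ℝ ∞ S ∧
      ∀ γ, S γ - primitive hε (superpose hV.continuous (S γ)) = γ := by
  let X := C(Icc (-ε) ε, E)
  let G : X → X := fun γ ↦ γ - primitive hε (superpose hV.continuous γ)
  have hLip : LipschitzWith L (superpose (I := Icc (-ε) ε) hV.continuous) := by
    refine LipschitzWith.of_dist_le_mul fun γ γ' ↦ ?_
    rw [ContinuousMap.dist_le (by positivity)]
    exact fun s ↦ (hL.dist_le_mul _ _).trans
      (mul_le_mul_of_nonneg_left (ContinuousMap.dist_apply_le_dist s) L.2)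
  -- `G` differs from the identity by a map of Lipschitz constant `ε * L < 1`, hence is a
  -- homeomorphism.
  have hG : ApproximatesLinearOn G ((ContinuousLinearEquiv.refl ℝ X : X ≃L[ℝ] X) : X →L[ℝ] X)
      univ (NNReal.mk ε hε.le * L) := by
    intro γ _ γ' _
    have : G γ - G γ' - ((ContinuousLinearEquiv.refl ℝ X : X ≃L[ℝ] X) : X →L[ℝ] X) (γ - γ') =
        - primitive hε (superpose hV.continuous γ - superpose hV.continuous γ') := by
      simp only [G, map_sub, ContinuousLinearEquiv.coe_refl, ContinuousLinearMap.coe_id', id]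
      abel
    rw [this, norm_neg]
    refine (norm_primitive_apply_le hε _).trans ?_
    rw [NNReal.coe_mul, NNReal.coe_mk, mul_assoc]
    exact mul_le_mul_of_nonneg_left (hLip.norm_sub_le γ γ') hε.le
  have hlt : Subsingleton X ∨ (NNReal.mk ε hε.le * L : NNReal) <
      ‖((ContinuousLinearEquiv.refl ℝ X).symm : X →L[ℝ] X)‖₊⁻¹ := by
    rcases subsingleton_or_nontrivial X with h | h
    · exact Or.inl h
    · right
      have : ‖((ContinuousLinearEquiv.refl ℝ X).symm : X →L[ℝ] X)‖₊ = 1 :=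
        ContinuousLinearMap.nnnorm_id
      rw [this, inv_one, ← NNReal.coe_lt_coe]
      exact hεL
  let h : X ≃ₜ X := hG.toHomeomorph G hlt
  have hGd : ContDiff ℝ ∞ G :=
    contDiff_id.sub ((contDiff_primitive hε).comp (contDiff_superpose hV hc))
  have hder : ∀ γ : X, ∃ e : X ≃L[ℝ] X, HasFDerivAt h (e : X →L[ℝ] X) γ := by
    intro γ
    let A : X →L[ℝ] X := (primitive hε).comp (pointwiseApply (Icc (-ε) ε) E E
      (superpose (hV.continuous_fderiv (by simp)) γ))
    -- By the Neumann series `1 - A`, the derivative of `G`, is then invertible, as smoothness of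
    -- the inverse requires.
    have hA : ‖A‖ < 1 := by
      refine lt_of_le_of_lt ?_ hεL
      refine (ContinuousLinearMap.opNorm_comp_le _ _).trans
        (mul_le_mul (norm_primitive_le hε) ((norm_pointwiseApply_le _).trans ?_)
          (norm_nonneg _) hε.le)
      exact (ContinuousMap.norm_le _ L.2).2 fun s ↦ hL' _
    refine ⟨ContinuousLinearEquiv.unitsEquiv ℝ X (Units.oneSub A hA), ?_⟩
    have h1 : HasFDerivAt G (ContinuousLinearMap.id ℝ X - A) γ :=
      (hasFDerivAt_id γ).sub (HasFDerivAt.comp (g := primitive hε) γ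
        (hasFDerivAt_primitive hε _) (hasFDerivAt_superpose (hV.of_le two_le_infty) hc γ))
    exact h1
  choose e he using hder
  exact ⟨h.symm, h.contDiff_symm he hGd, fun γ ↦ h.apply_symm_apply γ⟩

/-- A smooth compactly supported vector field on a Banach space has a smooth flow for short times,
which moves points by less than a prescribed amount; integrals along trajectories depend smoothly
on the initial point. -/
theorem exists_smooth_flow [CompleteSpace E] {V : E → E} (hV : ContDiff ℝ ∞ V)
    (hc : HasCompactSupport V) {r : ℝ} (hr : 0 < r) :
    ∃ ε > 0, ∃ Φ : ℝ → E → E, (∀ x, Φ 0 x = x) ∧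
      (∀ x, ∀ t ∈ Ioo (-ε) ε, HasDerivAt (fun s ↦ Φ s x) (V (Φ t x)) t) ∧
      (∀ t, ContDiff ℝ ∞ (Φ t)) ∧
      (∀ x, Continuous fun t ↦ Φ t x) ∧
      (∀ x, ∀ t ∈ Ioo (-ε) ε, ‖Φ t x - x‖ ≤ r) ∧
      (∀ w : E → ℝ, ContDiff ℝ ∞ w → HasCompactSupport w → ∀ t ∈ Ioo (-ε) ε,
        ContDiff ℝ ∞ fun x ↦ ∫ s in (0 : ℝ)..t, w (Φ s x)) := by
  obtain ⟨L, hL⟩ := ContDiff.lipschitzWith_of_hasCompactSupport hc hV (by simp)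
  have hL' : ∀ x, ‖fderiv ℝ V x‖ ≤ L := fun x ↦ norm_fderiv_le_of_lipschitz ℝ hL
  obtain ⟨B, hB⟩ := hc.exists_bound_of_continuous hV.continuous
  have hB0 : 0 ≤ B := (norm_nonneg _).trans (hB 0)
  -- The first bound makes the integral equation invertible, the second limits the displacement to
  -- `r`; the `+ 1` avoids division by zero.
  obtain ⟨ε, hε, hε1, hε2⟩ : ∃ ε : ℝ, 0 < ε ∧ ε * L < 1 ∧ ε * B ≤ r := by
    refine ⟨min (1 / (L + 1)) (r / (B + 1)), by positivity, ?_, ?_⟩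
    · calc _ ≤ 1 / ((L : ℝ) + 1) * L := by gcongr; exact min_le_left _ _
        _ < 1 := by rw [one_div_mul_eq_div, div_lt_one (by positivity)]; linarith
    · calc _ ≤ r / (B + 1) * B := by gcongr; exact min_le_right _ _
        _ ≤ r := by
          rw [div_mul_eq_mul_div, div_le_iff₀ (by positivity)]; nlinarith
  obtain ⟨S, hS, hSeq⟩ := exists_contDiff_solution hV hc hL hL' hε hε1
  -- Applying the inverse to the constant path at `x` solves `γ = x + ∫ V ∘ γ`, the integral form of
  -- the initial value problem.
  let T : E → C(Icc (-ε) ε, E) := fun x ↦ S (ContinuousMap.const _ x)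
  have hT : ContDiff ℝ ∞ T := by
    refine hS.comp ?_
    let K : E →L[ℝ] C(Icc (-ε) ε, E) := ContinuousLinearMap.const ℝ (Icc (-ε) ε)
    exact K.contDiff
  have hTeq : ∀ x, ∀ t ∈ Icc (-ε) ε,
      extendPath hε (T x) t = x + ∫ s in (0 : ℝ)..t, V (extendPath hε (T x) s) := by
    intro x t ht
    have h1 := congrArg (fun γ : C(Icc (-ε) ε, E) ↦ γ ⟨t, ht⟩) (hSeq (ContinuousMap.const _ x))
    simp only [ContinuousMap.sub_apply, primitive_apply, ContinuousMap.const_apply] at h1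
    rw [sub_eq_iff_eq_add] at h1
    have h2 : extendPath hε (T x) t = T x ⟨t, ht⟩ := IccExtend_of_mem _ _ ht
    rw [h2]
    exact h1
  have hcont : ∀ x, Continuous (extendPath hε (T x)) := fun x ↦ continuous_extendPath hε _
  refine ⟨ε, hε, fun t x ↦ extendPath hε (T x) t, fun x ↦ ?_, fun x t ht ↦ ?_, fun t ↦ ?_,
    hcont, fun x t ht ↦ ?_, fun w hw hwc t ht ↦ ?_⟩
  · simp [hTeq x 0 ⟨by linarith, hε.le⟩]
  · have h1 : HasDerivAt (fun t ↦ x + ∫ s in (0 : ℝ)..t, V (extendPath hε (T x) s))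
        (V (extendPath hε (T x) t)) t :=
      ((hV.continuous.comp (hcont x)).integral_hasStrictDerivAt 0 t).hasDerivAt.const_add x
    refine h1.congr_of_eventuallyEq ?_
    filter_upwards [Ioo_mem_nhds ht.1 ht.2] with s hs
    exact hTeq x s (Ioo_subset_Icc_self hs)
  · exact ((ContinuousMap.evalCLM ℝ (projIcc (-ε) ε (by linarith) t)).contDiff).comp hT
  · beta_reduce
    rw [hTeq x t (Ioo_subset_Icc_self ht), add_sub_cancel_left]
    refine (intervalIntegral.norm_integral_le_of_norm_le_const (fun s _ ↦ hB _)).trans ?_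
    rw [mul_comm, sub_zero]
    exact (mul_le_mul_of_nonneg_right (abs_le.2 ⟨ht.1.le, ht.2.le⟩) hB0).trans hε2
  -- The integral is evaluation at `t` of the primitive of a superposition, so it is smooth for the
  -- same reason as the flow.
  · have h1 : ContDiff ℝ ∞ fun x ↦ primitive hε (superpose hw.continuous (T x)) :=
      (contDiff_primitive hε).comp ((contDiff_superpose hw hwc).comp hT)
    exact ((ContinuousMap.evalCLM ℝ (⟨t, Ioo_subset_Icc_self ht⟩ : Icc (-ε) ε)).contDiff).comp h1

end Flow

/-! ### Smooth vector fields on manifolds and uniqueness of integral curves -/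

section Field

variable {m : ℕ} {M : Type*} [TopologicalSpace M] [ChartedSpace (EuclideanSpace ℝ (Fin m)) M]

/-- A vector field is smooth if it maps smooth functions to smooth functions. -/
def IsSmoothField (V : (x : M) → TangentSpace (𝓡 m) x) : Prop :=
  ∀ h : M → ℝ, ContMDiff (𝓡 m) 𝓘(ℝ, ℝ) ∞ h → ContMDiff (𝓡 m) 𝓘(ℝ, ℝ) ∞ (derivAlong V h)

variable {V : (x : M) → TangentSpace (𝓡 m) x}
  {F : Type*} [NormedAddCommGroup F] [NormedSpace ℝ F]
  {F' : Type*} [NormedAddCommGroup F'] [NormedSpace ℝ F']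

theorem derivAlong_eq_of_hasMFDerivAt {f : M → F} {x : M} {f' : TangentSpace (𝓡 m) x →L[ℝ] F}
    (hf : HasMFDerivAt (𝓡 m) 𝓘(ℝ, F) f x f') : derivAlong V f x = f' (V x) := by
  rw [derivAlong, mvfderiv, hf.mfderiv]
  rfl

theorem derivAlong_clm_comp (L : F →L[ℝ] F') {f : M → F} {x : M}
    (hf : MDifferentiableAt (𝓡 m) 𝓘(ℝ, F) f x) :
    derivAlong V (fun y ↦ L (f y)) x = L (derivAlong V f x) := by
  rw [derivAlong_eq_of_hasMFDerivAt hf.hasMFDerivAt]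
  exact derivAlong_eq_of_hasMFDerivAt (V := V)
    (HasMFDerivAt.comp x (L.hasFDerivAt.hasMFDerivAt) hf.hasMFDerivAt)

theorem derivAlong_congr {f g : M → F} {x : M} (h : f =ᶠ[𝓝 x] g) :
    derivAlong V f x = derivAlong V g x := by
  unfold derivAlong mvfderiv
  rw [h.mfderiv_eq, h.eq_of_nhds]

theorem derivAlong_eq_zero_of_notMem_tsupport {f : M → F} {x : M} (h : x ∉ tsupport f) :
    derivAlong V f x = 0 := by
  rw [derivAlong_congr (notMem_tsupport_iff_eventuallyEq.mp h)]
  have : derivAlong V (fun _ : M ↦ (0 : F)) x = 0 := by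
    simp [derivAlong, mvfderiv_const]
  exact this

theorem tsupport_derivAlong_subset (f : M → F) : tsupport (derivAlong V f) ⊆ tsupport f :=
  closure_minimal (fun _ hx ↦ by_contra fun h ↦ hx (derivAlong_eq_zero_of_notMem_tsupport h))
    (isClosed_tsupport f)

/-- Scalar test functions suffice because linear coordinates on `F` commute with `derivAlong`.
Testing on functions is also the form in which a Poisson structure provides smoothness of its
Hamiltonian fields. -/
theorem IsSmoothField.contMDiff (hV : IsSmoothField V) [FiniteDimensional ℝ F] {f : M → F}
    (hf : ContMDiff (𝓡 m) 𝓘(ℝ, F) ∞ f) : ContMDiff (𝓡 m) 𝓘(ℝ, F) ∞ (derivAlong V f) := by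
  let e : F ≃L[ℝ] (Fin (Module.finrank ℝ F) → ℝ) := ContinuousLinearEquiv.ofFinrankEq (by simp)
  have h1 : ContMDiff (𝓡 m) 𝓘(ℝ, Fin (Module.finrank ℝ F) → ℝ) ∞
      (fun x ↦ e (derivAlong V f x)) := by
    rw [contMDiff_pi_space]
    intro i
    let L : F →L[ℝ] ℝ := (ContinuousLinearMap.proj (R := ℝ) (φ := fun _ ↦ ℝ) i).comp
      (e : F →L[ℝ] (Fin (Module.finrank ℝ F) → ℝ))
    have h2 := hV (fun x ↦ L (f x)) (L.contDiff.contMDiff.comp hf)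
    have h3 : derivAlong V (fun x ↦ L (f x)) = fun x ↦ L (derivAlong V f x) := by
      ext x
      exact derivAlong_clm_comp L (hf.mdifferentiable (by simp) x)
    rw [h3] at h2
    exact h2
  have h2 : derivAlong V f = fun x ↦ e.symm (e (derivAlong V f x)) := by
    ext x
    simp
  rw [h2]
  exact e.symm.contDiff.contMDiff.comp h1

theorem hasDerivWithinAt_comp_integralCurve {γ : ℝ → M} {s : Set ℝ}
    (hγ : IsMIntegralCurveOn γ V s) {t : ℝ} (ht : t ∈ s) {f : M → F}
    (hf : MDifferentiableAt (𝓡 m) 𝓘(ℝ, F) f (γ t)) :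
    HasDerivWithinAt (fun t ↦ f (γ t)) (derivAlong V f (γ t)) s t := by
  have h := (hf.hasMFDerivAt.comp_hasMFDerivWithinAt t (hγ t ht)).hasFDerivWithinAt
  rw [hasDerivWithinAt_iff_hasFDerivWithinAt]
  refine h.congr_fderiv ?_
  rw [derivAlong_eq_of_hasMFDerivAt hf.hasMFDerivAt]
  refine ContinuousLinearMap.ext_ring ?_
  change mfderiv (𝓡 m) 𝓘(ℝ, F) f (γ t) ((1 : ℝ) • V (γ t)) =
    (1 : ℝ) • mfderiv (𝓡 m) 𝓘(ℝ, F) f (γ t) (V (γ t))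
  rw [one_smul]
  exact (one_smul ℝ _).symm

variable [IsManifold (𝓡 m) ∞ M]

/-- Multiplying by a bump function supported inside the chart target lets the Banach space results,
which need global compactly supported data, apply to local ones. -/
theorem exists_chart_extension [T2Space M] {f : M → F} (hf : ContMDiff (𝓡 m) 𝓘(ℝ, F) ∞ f)
    (p : M) :
    ∃ R > 0, ∃ g : EuclideanSpace ℝ (Fin m) → F, ContDiff ℝ ∞ g ∧ HasCompactSupport g ∧
      ∀ y ∈ Metric.ball (extChartAt (𝓡 m) p p) R, g y = f ((extChartAt (𝓡 m) p).symm y) := by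
  set e := extChartAt (𝓡 m) p
  obtain ⟨R, hR, hRt⟩ := Metric.nhds_basis_closedBall.mem_iff.1 (extChartAt_target_mem_nhds (I := 𝓡 m) p)
  let χ : ContDiffBump (e p) := ⟨R / 2, R, by positivity, by linarith⟩
  refine ⟨R / 2, by positivity, fun y ↦ χ y • f (e.symm y), ?_, χ.hasCompactSupport.smul_right,
    fun y hy ↦ ?_⟩
  · rw [contDiff_iff_contDiffAt]
    intro y
    by_cases hy : y ∈ e.target
    · have h1 : ContMDiffAt 𝓘(ℝ, EuclideanSpace ℝ (Fin m)) 𝓘(ℝ, F) ∞ (fun y ↦ f (e.symm y)) y :=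
        hf.contMDiffAt.comp y
          ((contMDiffOn_extChartAt_symm p).contMDiffAt
            ((isOpen_extChartAt_target p).mem_nhds hy))
      exact χ.contDiffAt.smul h1.contDiffAt
    · have h2 : y ∉ tsupport χ := by
        rw [χ.tsupport_eq]
        exact fun h ↦ hy (hRt h)
      refine (contDiffAt_const (c := (0 : F))).congr_of_eventuallyEq ?_
      filter_upwards [notMem_tsupport_iff_eventuallyEq.mp h2] with z hz
      simp [hz]
  · have : χ y = 1 := χ.one_of_mem_closedBall (Metric.ball_subset_closedBall hy)
    simp [this]

/-- In a chart, a smooth vector field agrees near a given point with a compactly supported smooth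
vector field on the model space. -/
theorem IsSmoothField.exists_chart_field [T2Space M] (hV : IsSmoothField V) (p : M) :
    ∃ R > 0, ∃ W : EuclideanSpace ℝ (Fin m) → EuclideanSpace ℝ (Fin m),
      ContDiff ℝ ∞ W ∧ HasCompactSupport W ∧
      ∀ y ∈ Metric.ball (extChartAt (𝓡 m) p p) R,
        W y = derivAlong V (extChartAt (𝓡 m) p) ((extChartAt (𝓡 m) p).symm y) := by
  set e := extChartAt (𝓡 m) p with he
  obtain ⟨b⟩ : Nonempty (SmoothBumpFunction (𝓡 m) p) := inferInstance
  -- The chart is not globally smooth, so it is cut off before `hV` applies. Where the cutoff is 1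
  -- on a neighbourhood, the derivative along `V` is unaffected.
  have hh : ContMDiff (𝓡 m) 𝓘(ℝ, EuclideanSpace ℝ (Fin m)) ∞ (fun x ↦ b x • e x) :=
    b.contMDiff_smul contMDiffOn_extChartAt
  obtain ⟨R, hR, W, hW, hWc, hWe⟩ := exists_chart_extension (hV.contMDiff hh) p
  have h1 : ∀ᶠ x in 𝓝 p, ∀ᶠ z in 𝓝 x, b z = 1 := b.eventuallyEq_one.eventually_nhds
  have h2 : ∀ᶠ y in 𝓝 (e p), ∀ᶠ z in 𝓝 (e.symm y), b z = 1 := by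
    have := continuousAt_extChartAt_symm (I := 𝓡 m) p
    rw [ContinuousAt, extChartAt_to_inv] at this
    exact this.eventually h1
  obtain ⟨R', hR', hb⟩ := Metric.eventually_nhds_iff_ball.1 h2
  refine ⟨min R R', lt_min hR hR', W, hW, hWc, fun y hy ↦ ?_⟩
  rw [hWe y (Metric.ball_subset_ball (min_le_left _ _) hy)]
  refine derivAlong_congr ?_
  filter_upwards [hb y (Metric.ball_subset_ball (min_le_right _ _) hy)] with z hz
  simp [hz]

/-- A chart solution is carried back to an integral curve because the derivatives of the chart and
of its inverse cancel. -/
theorem hasMFDerivAt_extChartAt_symm_comp {p : M} {η : ℝ → EuclideanSpace ℝ (Fin m)} {t : ℝ}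
    (ht : η t ∈ (extChartAt (𝓡 m) p).target)
    (hη : HasDerivAt η (derivAlong V (extChartAt (𝓡 m) p) ((extChartAt (𝓡 m) p).symm (η t))) t) :
    HasMFDerivAt 𝓘(ℝ, ℝ) (𝓡 m) (fun t ↦ (extChartAt (𝓡 m) p).symm (η t)) t
      ((1 : ℝ →L[ℝ] ℝ).smulRight (V ((extChartAt (𝓡 m) p).symm (η t)))) := by
  have : IsManifold (𝓡 m) 1 M := IsManifold.of_le (n := ∞) (by simp)
  set e := extChartAt (𝓡 m) p with he
  have h1 : MDifferentiableAt 𝓘(ℝ, EuclideanSpace ℝ (Fin m)) (𝓡 m) e.symm (η t) :=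
    ((contMDiffOn_extChartAt_symm (n := ∞) p).contMDiffAt
            ((isOpen_extChartAt_target p).mem_nhds ht)).mdifferentiableAt (by simp)
  have h2 := h1.hasMFDerivAt.comp t hη.hasFDerivAt.hasMFDerivAt
  refine h2.congr_mfderiv ?_
  have h3 := mfderivWithin_extChartAt_symm_comp_mfderiv_extChartAt (I := 𝓡 m) ht
  rw [ModelWithCorners.Boundaryless.range_eq_univ, mfderivWithin_univ] at h3
  have h4 := congrArg (fun L ↦ L (V (e.symm (η t)))) h3
  refine ContinuousLinearMap.ext_ring ?_
  change mfderiv 𝓘(ℝ, EuclideanSpace ℝ (Fin m)) (𝓡 m) e.symm (η t)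
    ((1 : ℝ) • derivAlong V e (e.symm (η t))) = (1 : ℝ) • V (e.symm (η t))
  rw [one_smul, one_smul]
  exact h4

/-- Integral curves of a smooth vector field on a closed interval are determined by their
initial point. -/
theorem IsSmoothField.eqOn_Icc [T2Space M] (hV : IsSmoothField V) {γ γ' : ℝ → M} {a b : ℝ}
    (hγ : IsMIntegralCurveOn γ V (Icc a b)) (hγ' : IsMIntegralCurveOn γ' V (Icc a b))
    (h0 : γ a = γ' a) : EqOn γ γ' (Icc a b) := by
  have hcl : IsClosed ({t | γ t = γ' t} ∩ Icc a b) := by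
    rw [inter_comm]
    exact (hγ.continuousOn.prodMk hγ'.continuousOn).preimage_isClosed_of_isClosed
      isClosed_Icc isClosed_diagonal
  -- Continuous induction: the coincidence set is closed, and each of its points before `b` can be
  -- prolonged to the right by ODE uniqueness in a chart.
  refine hcl.Icc_subset_of_forall_exists_gt h0 ?_
  rintro x ⟨hx, hxab⟩ y hy
  have hxI : x ∈ Icc a b := Ico_subset_Icc_self hxab
  obtain ⟨R, hR, W, hW, hWc, hWe⟩ := hV.exists_chart_field (γ x)
  set e := extChartAt (𝓡 m) (γ x) with he
  obtain ⟨L, hL⟩ := ContDiff.lipschitzWith_of_hasCompactSupport hWc hW (by simp)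
  have hN : e.source ∩ e ⁻¹' Metric.ball (e (γ x)) R ∈ 𝓝 (γ x) :=
    inter_mem (extChartAt_source_mem_nhds _)
      ((continuousAt_extChartAt _).preimage_mem_nhds (Metric.ball_mem_nhds _ hR))
  have hev : ∀ᶠ t in 𝓝[Icc a b] x, γ t ∈ e.source ∩ e ⁻¹' Metric.ball (e (γ x)) R ∧
      γ' t ∈ e.source ∩ e ⁻¹' Metric.ball (e (γ x)) R :=
    ((hγ.continuousOn x hxI).eventually hN).and
      ((hγ'.continuousOn x hxI).eventually (by rwa [← show γ x = γ' x from hx]))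
  have hev' : ∀ᶠ t in 𝓝[≥] x, γ t ∈ e.source ∩ e ⁻¹' Metric.ball (e (γ x)) R ∧
      γ' t ∈ e.source ∩ e ⁻¹' Metric.ball (e (γ x)) R := by
    rw [← nhdsWithin_Icc_eq_nhdsGE hxab.2]
    exact hev.filter_mono (nhdsWithin_mono _ (Icc_subset_Icc_left hxab.1))
  obtain ⟨c, ⟨hxc, hcy⟩, hc⟩ := (mem_nhdsGE_iff_exists_mem_Ioc_Ico_subset
    (lt_min (mem_Ioi.1 hy) hxab.2)).1 hev'
  obtain ⟨d, hxd, hdc⟩ := exists_between hxc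
  have hdb : d < b := hdc.trans_le (hcy.trans (min_le_right _ _))
  have hsub : Icc x d ⊆ Icc a b := Icc_subset_Icc hxab.1 hdb.le
  have key : ∀ η : ℝ → M, IsMIntegralCurveOn η V (Icc a b) →
      (∀ t ∈ Icc x d, η t ∈ e.source ∩ e ⁻¹' Metric.ball (e (γ x)) R) →
      ContinuousOn (fun t ↦ e (η t)) (Icc x d) ∧
      ∀ t ∈ Ico x d, HasDerivWithinAt (fun t ↦ e (η t)) (W (e (η t))) (Ici t) t := by
    intro η hη hηs
    have h1 : ∀ t ∈ Icc x d, HasDerivWithinAt (fun t ↦ e (η t)) (W (e (η t))) (Icc a b) t := by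
      intro t ht
      rw [hWe _ (hηs t ht).2, e.left_inv (hηs t ht).1]
      exact hasDerivWithinAt_comp_integralCurve hη (hsub ht)
        (((contMDiffAt_extChartAt' (n := ∞) (by
          rw [← extChartAt_source (𝓡 m)]; exact (hηs t ht).1))).mdifferentiableAt (by simp))
    refine ⟨fun t ht ↦ ((h1 t ht).mono hsub).continuousWithinAt, fun t ht ↦ ?_⟩
    refine (h1 t (Ico_subset_Icc_self ht)).mono_of_mem_nhdsWithin ?_
    exact Icc_mem_nhdsGE_of_mem ⟨hxab.1.trans ht.1, ht.2.trans hdb⟩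
  have hmem : ∀ t ∈ Icc x d, t ∈ Ico x c := fun t ht ↦ ⟨ht.1, ht.2.trans_lt hdc⟩
  obtain ⟨k1, k2⟩ := key γ hγ fun t ht ↦ (hc (hmem t ht)).1
  obtain ⟨k3, k4⟩ := key γ' hγ' fun t ht ↦ (hc (hmem t ht)).2
  have hd : d ∈ Icc x d := ⟨hxd.le, le_rfl⟩
  have := ODE_solution_unique (fun _ ↦ hL) k1 k2 k3 k4 (by simp [show γ x = γ' x from hx]) hd
  exact ⟨d, e.injOn (hc (hmem d hd)).1.1 (hc (hmem d hd)).2.1 this, hxd,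
    hdc.le.trans (hcy.trans (min_le_left _ _))⟩

theorem IsSmoothField.smul (hV : IsSmoothField V) (c : ℝ) : IsSmoothField (c • V) := by
  intro h hh
  have : derivAlong (c • V) h = fun x ↦ c * derivAlong V h x := by
    ext x
    simp [derivAlong]
  rw [this]
  exact contMDiff_const.mul (hV h hh)

/-- Rescaling time by `t`, of either sign, gives integral curves of `t • V` on `[0, 1]`. -/
theorem IsSmoothField.eqOn_uIcc [T2Space M] (hV : IsSmoothField V) {γ γ' : ℝ → M} {t : ℝ}
    (hγ : IsMIntegralCurveOn γ V (uIcc 0 t)) (hγ' : IsMIntegralCurveOn γ' V (uIcc 0 t))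
    (h0 : γ 0 = γ' 0) : EqOn γ γ' (uIcc 0 t) := by
  have hmap : ∀ s ∈ Icc (0 : ℝ) 1, s * t ∈ uIcc 0 t := by
    intro s hs
    rcases le_total 0 t with ht | ht
    · rw [uIcc_of_le ht]
      exact ⟨mul_nonneg hs.1 ht, mul_le_of_le_one_left ht hs.2⟩
    · rw [uIcc_of_ge ht]
      exact ⟨by nlinarith [hs.2], mul_nonpos_of_nonneg_of_nonpos hs.1 ht⟩
  have h := (hV.smul t).eqOn_Icc ((hγ.comp_mul t).mono hmap) ((hγ'.comp_mul t).mono hmap)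
    (by simpa using h0)
  intro s hs
  rcases eq_or_ne t 0 with rfl | ht
  · simp only [uIcc_self, mem_singleton_iff] at hs
    rw [hs, h0]
  · have h1 : s / t ∈ Icc (0 : ℝ) 1 := by
      rcases lt_or_gt_of_ne ht with ht | ht
      · rw [uIcc_of_ge ht.le] at hs
        exact ⟨div_nonneg_of_nonpos hs.2 ht.le, (div_le_one_of_neg ht).2 hs.1⟩
      · rw [uIcc_of_le ht.le] at hs
        exact ⟨div_nonneg hs.1 ht.le, (div_le_one ht).2 hs.2⟩
    simpa [ht] using h h1

end Field

/-! ### Flow boxes -/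

section Box

variable {m : ℕ} {M : Type*} [TopologicalSpace M] [ChartedSpace (EuclideanSpace ℝ (Fin m)) M]

/-- A local flow of `V`, defined for times in `(-ε, ε)` on the open set `large`, which maps the
open set `small` into a compact subset of `large`, and along which `w` is bounded and has
integrals depending smoothly on the initial point. -/
structure FlowBox (V : (x : M) → TangentSpace (𝓡 m) x) (w : M → ℝ) where
  ε : ℝ
  ε_pos : 0 < ε
  small : Set M
  large : Set M
  core : Set M
  flow : ℝ → M → M
  bound : ℝ
  isOpen_small : IsOpen small
  isOpen_large : IsOpen large
  isCompact_core : IsCompact core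
  core_subset : core ⊆ large
  small_subset : small ⊆ large
  flow_zero : ∀ x ∈ large, flow 0 x = x
  isMIntegralCurveOn : ∀ x ∈ large, IsMIntegralCurveOn (fun t ↦ flow t x) V (Ioo (-ε) ε)
  flow_mem_core : ∀ x ∈ small, ∀ t ∈ Ioo (-ε) ε, flow t x ∈ core
  contMDiffOn_flow : ∀ t ∈ Ioo (-ε) ε, ContMDiffOn (𝓡 m) (𝓡 m) ∞ (flow t) large
  contMDiffOn_integral : ∀ t ∈ Ioo (-ε) ε,
    ContMDiffOn (𝓡 m) 𝓘(ℝ, ℝ) ∞ (fun x ↦ ∫ s in (0 : ℝ)..t, w (flow s x)) large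
  abs_le_bound : ∀ x ∈ large, ∀ t ∈ Ioo (-ε) ε, |w (flow t x)| ≤ bound

variable {V : (x : M) → TangentSpace (𝓡 m) x} {w : M → ℝ} [IsManifold (𝓡 m) ∞ M]

theorem uIcc_subset_Ioo_symm {ε t : ℝ} (hε : 0 < ε) (ht : t ∈ Ioo (-ε) ε) :
    uIcc 0 t ⊆ Ioo (-ε) ε :=
  ordConnected_Ioo.uIcc_subset ⟨by linarith, hε⟩ ht

/-- In a chart ball of radius `R` where `V` and `w` agree with compactly supported data, points move
by at most `R / 4`. Hence radius `R / 4` stays within the compact ball of radius `R / 2`, and radius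
`3 * R / 4` stays within `R`. -/
theorem IsSmoothField.exists_flowBox [T2Space M] (hV : IsSmoothField V)
    (hw : ContMDiff (𝓡 m) 𝓘(ℝ, ℝ) ∞ w) (p : M) : ∃ b : FlowBox V w, p ∈ b.small := by
  obtain ⟨R₁, hR₁, W, hW, hWc, hWe⟩ := hV.exists_chart_field p
  obtain ⟨R₂, hR₂, v, hv, hvc, hve⟩ := exists_chart_extension hw p
  obtain ⟨R₃, hR₃, hR₃t⟩ :=
    Metric.nhds_basis_ball.mem_iff.1 (extChartAt_target_mem_nhds (I := 𝓡 m) p)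
  set e := extChartAt (𝓡 m) p with he
  obtain ⟨R, hR, h1, h2, h3⟩ : ∃ R > 0, R ≤ R₁ ∧ R ≤ R₂ ∧ R ≤ R₃ :=
    ⟨min R₁ (min R₂ R₃), by positivity, min_le_left _ _, (min_le_right _ _).trans (min_le_left _ _),
      (min_le_right _ _).trans (min_le_right _ _)⟩
  have hball : ∀ y ∈ Metric.ball (e p) R, y ∈ e.target ∧
      W y = derivAlong V e (e.symm y) ∧ v y = w (e.symm y) := fun y hy ↦
    ⟨hR₃t (Metric.ball_subset_ball h3 hy), hWe y (Metric.ball_subset_ball h1 hy),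
      hve y (Metric.ball_subset_ball h2 hy)⟩
  obtain ⟨B, hB⟩ := hvc.exists_bound_of_continuous hv.continuous
  obtain ⟨ε, hε, Φ, hΦ0, hΦd, hΦs, hΦc, hΦr, hΦi⟩ :=
    exists_smooth_flow hW hWc (r := R / 4) (by positivity)
  have hstay : ∀ {y : EuclideanSpace ℝ (Fin m)} {ρ t : ℝ}, y ∈ Metric.ball (e p) ρ →
      t ∈ Ioo (-ε) ε → Φ t y ∈ Metric.ball (e p) (ρ + R / 4) := by
    intro y ρ t hy ht
    have := hΦr y t ht
    rw [← dist_eq_norm] at this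
    rw [Metric.mem_ball] at hy ⊢
    linarith [dist_triangle (Φ t y) y (e p)]
  have hopen : ∀ ρ, IsOpen (e.source ∩ e ⁻¹' Metric.ball (e p) ρ) := fun ρ ↦
    (continuousOn_extChartAt p).isOpen_inter_preimage (isOpen_extChartAt_source p)
      Metric.isOpen_ball
  have hlarge : ∀ x ∈ e.source ∩ e ⁻¹' Metric.ball (e p) (3 * R / 4), ∀ t ∈ Ioo (-ε) ε,
      Φ t (e x) ∈ Metric.ball (e p) R := by
    intro x hx t ht
    have := hstay hx.2 ht
    rwa [show 3 * R / 4 + R / 4 = R by ring] at this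
  have hsymm : ContMDiffOn 𝓘(ℝ, EuclideanSpace ℝ (Fin m)) (𝓡 m) ∞ e.symm e.target :=
    contMDiffOn_extChartAt_symm p
  have hchart : ContMDiffOn (𝓡 m) 𝓘(ℝ, EuclideanSpace ℝ (Fin m)) ∞ e e.source := by
    rw [he, extChartAt_source]
    exact contMDiffOn_extChartAt
  have hmono : Metric.closedBall (e p) (R / 2) ⊆ e.target := fun y hy ↦
    (hball y (Metric.closedBall_subset_ball (by linarith) hy)).1
  refine ⟨{ ε := ε, ε_pos := hε
            small := e.source ∩ e ⁻¹' Metric.ball (e p) (R / 4)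
            large := e.source ∩ e ⁻¹' Metric.ball (e p) (3 * R / 4)
            core := e.symm '' Metric.closedBall (e p) (R / 2)
            flow := fun t x ↦ e.symm (Φ t (e x))
            bound := B
            isOpen_small := hopen _
            isOpen_large := hopen _
            isCompact_core := (isCompact_closedBall _ _).image_of_continuousOn
              (hsymm.continuousOn.mono hmono)
            core_subset := ?_
            small_subset := ?_
            flow_zero := ?_
            isMIntegralCurveOn := ?_
            flow_mem_core := ?_
            contMDiffOn_flow := ?_
            contMDiffOn_integral := ?_
            abs_le_bound := ?_ }, ?_⟩
  · rintro _ ⟨y, hy, rfl⟩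
    refine ⟨e.map_target (hmono hy), ?_⟩
    rw [mem_preimage, e.right_inv (hmono hy)]
    exact Metric.closedBall_subset_ball (by linarith) hy
  · exact inter_subset_inter_right _ (preimage_mono (Metric.ball_subset_ball (by linarith)))
  · intro x hx
    simp [hΦ0, e.left_inv hx.1]
  · intro x hx t ht
    have hb := hball _ (hlarge x hx t ht)
    have hd := hΦd (e x) t ht
    rw [hb.2.1] at hd
    exact (hasMFDerivAt_extChartAt_symm_comp hb.1 hd).hasMFDerivWithinAt
  · intro x hx t ht
    refine ⟨_, Metric.ball_subset_closedBall ?_, rfl⟩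
    have := hstay hx.2 ht
    rwa [show R / 4 + R / 4 = R / 2 by ring] at this
  · intro t ht
    refine hsymm.comp (((hΦs t).contMDiff).comp_contMDiffOn (hchart.mono inter_subset_left)) ?_
    exact fun x hx ↦ (hball _ (hlarge x hx t ht)).1
  · intro t ht
    refine (((hΦi v hv hvc t ht).contMDiff).comp_contMDiffOn
      (hchart.mono inter_subset_left)).congr fun x hx ↦ ?_
    refine intervalIntegral.integral_congr fun s hs ↦ ?_
    exact (hball _ (hlarge x hx s (uIcc_subset_Ioo_symm hε ht hs))).2.2.symm
  · intro x hx t ht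
    rw [← (hball _ (hlarge x hx t ht)).2.2]
    exact hB _
  · exact ⟨mem_extChartAt_source p, Metric.mem_ball_self (by positivity)⟩

end Box

/-! ### Weighted pull-back in a flow box and its generator -/

section Transport

variable {m : ℕ} {M : Type*} [TopologicalSpace M] [ChartedSpace (EuclideanSpace ℝ (Fin m)) M]

theorem ofReal_comp_mem {f : M → ℝ} (hf : ContMDiff (𝓡 m) 𝓘(ℝ, ℝ) ∞ f)
    (hc : HasCompactSupport f) : (fun x ↦ (f x : ℂ)) ∈ testFunctions m M :=
  ⟨Complex.ofRealCLM.contDiff.contMDiff.comp hf, hc.comp_left Complex.ofReal_zero⟩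

/-- `u` is the pull-back of `f` along the time-`t` flow map of `V`, multiplied by the exponential
of the integral of `w` along trajectories, and extended by zero. -/
def IsTransport (V : (x : M) → TangentSpace (𝓡 m) x) (w : M → ℝ) (t : ℝ) (f u : M → ℂ) : Prop :=
  ∀ x, (∀ γ : ℝ → M, IsMIntegralCurveOn γ V (uIcc 0 t) → γ 0 = x →
      u x = (Real.exp (∫ s in (0 : ℝ)..t, w (γ s)) : ℂ) * f (γ t)) ∧
    ((¬ ∃ γ : ℝ → M, IsMIntegralCurveOn γ V (uIcc 0 t) ∧ γ 0 = x) → u x = 0)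

/-- The first order operator `f ↦ V f + w f`. -/
def generator (V : (x : M) → TangentSpace (𝓡 m) x) (w : M → ℝ) (f : M → ℂ) (x : M) : ℂ :=
  derivAlong V f x + w x * f x

variable {V : (x : M) → TangentSpace (𝓡 m) x} {w : M → ℝ}

theorem generator_eq_zero_of_notMem_tsupport {f : M → ℂ} {x : M} (hx : x ∉ tsupport f) :
    generator V w f x = 0 := by
  simp [generator, derivAlong_eq_zero_of_notMem_tsupport hx, image_eq_zero_of_notMem_tsupport hx]

theorem tsupport_generator_subset (f : M → ℂ) : tsupport (generator V w f) ⊆ tsupport f :=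
  closure_minimal (fun _ hx ↦ by_contra fun h ↦ hx (generator_eq_zero_of_notMem_tsupport h))
    (isClosed_tsupport f)

theorem generator_mem (hV : IsSmoothField V) (hw : ContMDiff (𝓡 m) 𝓘(ℝ, ℝ) ∞ w) {f : M → ℂ}
    (hf : f ∈ testFunctions m M) : generator V w f ∈ testFunctions m M :=
  ⟨(hV.contMDiff hf.1).add (contMDiff_mulC (Complex.ofRealCLM.contDiff.contMDiff.comp hw) hf.1),
    hf.2.of_isClosed_subset (isClosed_tsupport _) (tsupport_generator_subset f)⟩

theorem hasDerivAt_exp_mul {a : ℝ → ℝ} {a' : ℝ} {c : ℝ → ℂ} {c' : ℂ} {t : ℝ}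
    (ha : HasDerivAt a a' t) (hc : HasDerivAt c c' t) :
    HasDerivAt (fun t ↦ (Real.exp (a t) : ℂ) * c t)
      ((Real.exp (a t) : ℂ) * (c' + a' * c t)) t := by
  refine (ha.exp.ofReal_comp.fun_mul hc).congr_deriv ?_
  push_cast
  ring

namespace FlowBox

open Classical in
/-- The weighted pull-back of `f` along the local flow of a flow box. -/
def push (b : FlowBox V w) (t : ℝ) (f : M → ℂ) (x : M) : ℂ :=
  if x ∈ b.large then
    (Real.exp (∫ s in (0 : ℝ)..t, w (b.flow s x)) : ℂ) * f (b.flow t x) else 0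

variable (b : FlowBox V w) {t : ℝ} {f : M → ℂ} {x : M}

theorem push_of_mem (hx : x ∈ b.large) : b.push t f x =
    (Real.exp (∫ s in (0 : ℝ)..t, w (b.flow s x)) : ℂ) * f (b.flow t x) := if_pos hx

theorem push_of_notMem (hx : x ∉ b.large) : b.push t f x = 0 := if_neg hx

theorem uIcc_subset (ht : t ∈ Ioo (-b.ε) b.ε) : uIcc 0 t ⊆ Ioo (-b.ε) b.ε :=
  uIcc_subset_Ioo_symm b.ε_pos ht

theorem neg_mem (ht : t ∈ Ioo (-b.ε) b.ε) : -t ∈ Ioo (-b.ε) b.ε :=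
  ⟨by linarith [ht.2], by linarith [ht.1]⟩

variable [IsManifold (𝓡 m) ∞ M] [T2Space M]

theorem eqOn_flow (hV : IsSmoothField V) (ht : t ∈ Ioo (-b.ε) b.ε) (hx : x ∈ b.large)
    {γ : ℝ → M} (hγ : IsMIntegralCurveOn γ V (uIcc 0 t)) (h0 : γ 0 = x) :
    EqOn γ (fun s ↦ b.flow s x) (uIcc 0 t) :=
  hV.eqOn_uIcc hγ ((b.isMIntegralCurveOn x hx).mono (b.uIcc_subset ht))
    (by rw [h0, b.flow_zero x hx])

/-- An integral curve ending in the small set started at the image of its end point under the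
backward flow. -/
theorem eq_flow_neg (hV : IsSmoothField V) (ht : t ∈ Ioo (-b.ε) b.ε) {γ : ℝ → M}
    (hγ : IsMIntegralCurveOn γ V (uIcc 0 t)) (h : γ t ∈ b.small) :
    γ 0 = b.flow (-t) (γ t) := by
  have h1 : IsMIntegralCurveOn (γ ∘ (· + t)) V (uIcc 0 (-t)) := by
    refine (hγ.comp_add t).mono fun s hs ↦ ?_
    have := (mem_image_of_mem (· + t) hs)
    rw [image_add_const_uIcc] at this
    simpa [uIcc_comm] using this
  have := b.eqOn_flow hV (b.neg_mem ht) (b.small_subset h) h1 (by simp) right_mem_uIcc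
  simpa using this

/-- The point to check is a start outside `large`, where `push` is zero: a curve from there cannot
end in `small`, since running it backwards would put its start in `core ⊆ large`. -/
theorem isTransport_push (hV : IsSmoothField V) (hf : tsupport f ⊆ b.small)
    (ht : t ∈ Ioo (-b.ε) b.ε) : IsTransport V w t f (b.push t f) := by
  refine fun x ↦ ⟨fun γ hγ h0 ↦ ?_, fun h ↦ b.push_of_notMem fun hx ↦ h ⟨fun s ↦ b.flow s x,
    (b.isMIntegralCurveOn x hx).mono (b.uIcc_subset ht), b.flow_zero x hx⟩⟩
  by_cases hx : x ∈ b.large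
  · have h := b.eqOn_flow hV ht hx hγ h0
    rw [b.push_of_mem hx, h right_mem_uIcc]
    congr 3
    exact intervalIntegral.integral_congr fun s hs ↦ by rw [h hs]
  · rw [b.push_of_notMem hx]
    by_cases h : γ t ∈ b.small
    · refine absurd ?_ hx
      rw [← h0, b.eq_flow_neg hV ht hγ h]
      exact b.core_subset (b.flow_mem_core _ h _ (b.neg_mem ht))
    · rw [image_eq_zero_of_notMem_tsupport fun h' ↦ h (hf h'), mul_zero]

theorem tsupport_push_subset (hV : IsSmoothField V) (hf : tsupport f ⊆ b.small)
    (hfc : HasCompactSupport f) (ht : t ∈ Ioo (-b.ε) b.ε) :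
    tsupport (b.push t f) ⊆ b.flow (-t) '' tsupport f := by
  refine closure_minimal (fun x hx ↦ ?_) ((hfc.image_of_continuousOn ?_).isClosed)
  · have hxl : x ∈ b.large := by
      by_contra h
      exact hx (b.push_of_notMem h)
    have h1 : f (b.flow t x) ≠ 0 := by
      rw [Function.mem_support, b.push_of_mem hxl] at hx
      exact right_ne_zero_of_mul hx
    have h2 := subset_tsupport f h1
    refine ⟨_, h2, ?_⟩
    have := b.eq_flow_neg hV ht ((b.isMIntegralCurveOn x hxl).mono (b.uIcc_subset ht)) (hf h2)
    rw [← this, b.flow_zero x hxl]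
  · exact (b.contMDiffOn_flow _ (b.neg_mem ht)).continuousOn.mono (hf.trans b.small_subset)

theorem tsupport_push_subset_core (hV : IsSmoothField V) (hf : tsupport f ⊆ b.small)
    (hfc : HasCompactSupport f) (ht : t ∈ Ioo (-b.ε) b.ε) :
    tsupport (b.push t f) ⊆ b.core := by
  refine (b.tsupport_push_subset hV hf hfc ht).trans ?_
  rintro _ ⟨y, hy, rfl⟩
  exact b.flow_mem_core y (hf hy) _ (b.neg_mem ht)

/-- The support lies in the compact `core` inside the open set `large`, so the extension by zero
stays smooth. -/
theorem push_mem (hV : IsSmoothField V) (hf : tsupport f ⊆ b.small)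
    (hft : f ∈ testFunctions m M) (ht : t ∈ Ioo (-b.ε) b.ε) :
    b.push t f ∈ testFunctions m M := by
  have hK := b.tsupport_push_subset_core hV hf hft.2 ht
  refine ⟨fun x ↦ ?_, b.isCompact_core.of_isClosed_subset (isClosed_tsupport _) hK⟩
  by_cases hx : x ∈ b.large
  · have h1 : ContMDiffOn (𝓡 m) 𝓘(ℝ, ℂ) ∞ (fun x ↦
        (Real.exp (∫ s in (0 : ℝ)..t, w (b.flow s x)) : ℂ) * f (b.flow t x)) b.large := by
      have h2 : ContMDiffOn (𝓡 m) 𝓘(ℝ, ℂ) ∞ (fun x ↦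
          (Real.exp (∫ s in (0 : ℝ)..t, w (b.flow s x)) : ℂ)) b.large :=
        ((Complex.ofRealCLM.contDiff.comp Real.contDiff_exp).contMDiff).comp_contMDiffOn
          (b.contMDiffOn_integral t ht)
      have h3 : ContMDiffOn (𝓡 m) 𝓘(ℝ, ℂ) ∞ (fun x ↦ f (b.flow t x)) b.large :=
        hft.1.comp_contMDiffOn (b.contMDiffOn_flow t ht)
      exact (contDiff_mul (𝕜 := ℝ) (𝔸 := ℂ) (n := ∞)).contMDiff.comp_contMDiffOn
        (h2.prodMk_space h3)
    exact (h1.congr fun y hy ↦ b.push_of_mem hy).contMDiffAt (b.isOpen_large.mem_nhds hx)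
  · have h1 : x ∉ tsupport (b.push t f) := fun h ↦ hx (b.core_subset (hK h))
    exact contMDiffAt_const.congr_of_eventuallyEq (notMem_tsupport_iff_eventuallyEq.mp h1)

theorem hasDerivAt_integral (hw : Continuous w) (hx : x ∈ b.large) (ht : t ∈ Ioo (-b.ε) b.ε) :
    HasDerivAt (fun t ↦ ∫ s in (0 : ℝ)..t, w (b.flow s x)) (w (b.flow t x)) t := by
  have hc : ContinuousOn (fun s ↦ w (b.flow s x)) (Ioo (-b.ε) b.ε) :=
    hw.comp_continuousOn (b.isMIntegralCurveOn x hx).continuousOn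
  exact intervalIntegral.integral_hasDerivAt_right
    (hc.mono (b.uIcc_subset ht)).intervalIntegrable
    (hc.stronglyMeasurableAtFilter isOpen_Ioo t ht) (hc.continuousAt (isOpen_Ioo.mem_nhds ht))

theorem hasDerivAt_flow_comp (hf : ContMDiff (𝓡 m) 𝓘(ℝ, ℂ) ∞ f) (hx : x ∈ b.large)
    (ht : t ∈ Ioo (-b.ε) b.ε) :
    HasDerivAt (fun t ↦ f (b.flow t x)) (derivAlong V f (b.flow t x)) t :=
  (hasDerivWithinAt_comp_integralCurve (b.isMIntegralCurveOn x hx) ht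
    (hf.mdifferentiable (by simp) _)).hasDerivAt (isOpen_Ioo.mem_nhds ht)

theorem hasDerivAt_push (hw : Continuous w) (hf : ContMDiff (𝓡 m) 𝓘(ℝ, ℂ) ∞ f)
    (ht : t ∈ Ioo (-b.ε) b.ε) :
    HasDerivAt (fun t ↦ b.push t f x) (b.push t (generator V w f) x) t := by
  by_cases hx : x ∈ b.large
  · simp only [b.push_of_mem hx]
    exact hasDerivAt_exp_mul (b.hasDerivAt_integral hw hx ht) (b.hasDerivAt_flow_comp hf hx ht)
  · simp only [b.push_of_notMem hx]
    exact hasDerivAt_const _ _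

/-- The weighted pull-back commutes with its generator. -/
theorem push_generator (hV : IsSmoothField V) (hw : Continuous w) (hft : f ∈ testFunctions m M)
    (hf : tsupport f ⊆ b.small) (ht : t ∈ Ioo (-b.ε) b.ε) :
    b.push t (generator V w f) = generator V w (b.push t f) := by
  ext x
  by_cases hx : x ∈ b.large
  · have h0 : (0 : ℝ) ∈ Ioo (-b.ε) b.ε := ⟨by linarith [b.ε_pos], b.ε_pos⟩
    -- The same function of `h` is differentiated at 0 in two ways: directly, and after splitting
    -- time `h + t` into `h` followed by `t`.
    have h1 : HasDerivAt (fun h ↦ b.push (h + t) f x) (b.push t (generator V w f) x) 0 :=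
      HasDerivAt.comp_add_const 0 t (by simpa using b.hasDerivAt_push (x := x) hw hft.1 ht)
    have h2 := hasDerivAt_exp_mul (b.hasDerivAt_integral hw hx h0)
      (b.hasDerivAt_flow_comp (b.push_mem hV hf hft ht).1 hx h0)
    simp only [b.flow_zero x hx, intervalIntegral.integral_same, Real.exp_zero,
      Complex.ofReal_one, one_mul] at h2
    refine h1.unique (h2.congr_of_eventuallyEq ?_)
    have hn : ∀ᶠ h in 𝓝 (0 : ℝ), h ∈ Ioo (-b.ε) b.ε ∧ h + t ∈ Ioo (-b.ε) b.ε := by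
      refine (isOpen_Ioo.eventually_mem h0).and ?_
      exact (continuous_id.add continuous_const).continuousAt.preimage_mem_nhds
        (isOpen_Ioo.mem_nhds (by simpa using ht))
    filter_upwards [hn] with h ⟨hh, hht⟩
    have hsub : uIcc h (h + t) ⊆ Ioo (-b.ε) b.ε := ordConnected_Ioo.uIcc_subset hh hht
    -- The trajectory restarted at time `h` evaluates `push t f` at `b.flow h x`; this is the group
    -- law, with the weights multiplying.
    have h3 : IsMIntegralCurveOn ((fun s ↦ b.flow s x) ∘ (· + h)) V (uIcc 0 t) := by
      refine ((b.isMIntegralCurveOn x hx).comp_add h).mono fun s hs ↦ hsub ?_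
      have := (mem_image_of_mem (· + h) hs)
      rw [image_add_const_uIcc] at this
      simpa [add_comm] using this
    have h4 := (b.isTransport_push hV hf ht (b.flow h x)).1 _ h3 (by simp)
    have hc : ContinuousOn (fun s ↦ w (b.flow s x)) (Ioo (-b.ε) b.ε) :=
      hw.comp_continuousOn (b.isMIntegralCurveOn x hx).continuousOn
    have h5 : (∫ s in (0 : ℝ)..t, w (((fun s ↦ b.flow s x) ∘ (· + h)) s)) =
        ∫ s in h..(h + t), w (b.flow s x) := by
      have := intervalIntegral.integral_comp_add_right (a := 0) (b := t)
        (fun s ↦ w (b.flow s x)) h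
      simpa [add_comm] using this
    rw [h4, h5, b.push_of_mem hx, ← mul_assoc, ← Complex.ofReal_mul, ← Real.exp_add,
      intervalIntegral.integral_add_adjacent_intervals
        (hc.mono (b.uIcc_subset hh)).intervalIntegrable (hc.mono hsub).intervalIntegrable]
    simp [add_comm]
  · rw [b.push_of_notMem hx, generator_eq_zero_of_notMem_tsupport]
    exact fun h ↦ hx (b.core_subset (b.tsupport_push_subset_core hV hf hft.2 ht h))

theorem norm_push_le {C : ℝ} (hC : ∀ x, ‖f x‖ ≤ C) (ht : t ∈ Ioo (-b.ε) b.ε) (x : M) :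
    ‖b.push t f x‖ ≤ Real.exp (|b.bound| * b.ε) * C := by
  have hC0 : 0 ≤ C := (norm_nonneg _).trans (hC x)
  by_cases hx : x ∈ b.large
  · rw [b.push_of_mem hx, norm_mul, Complex.norm_real, Real.norm_eq_abs, Real.abs_exp]
    refine mul_le_mul (Real.exp_le_exp.2 ?_) (hC _) (norm_nonneg _) (Real.exp_pos _).le
    have h1 : ‖∫ s in (0 : ℝ)..t, w (b.flow s x)‖ ≤ |b.bound| * |t - 0| :=
      intervalIntegral.norm_integral_le_of_norm_le_const fun s hs ↦
        (b.abs_le_bound x hx s (b.uIcc_subset ht (uIoc_subset_uIcc hs))).trans (le_abs_self _)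
    rw [sub_zero] at h1
    exact (le_abs_self _).trans (h1.trans
      (mul_le_mul_of_nonneg_left (abs_le.2 ⟨ht.1.le, ht.2.le⟩) (abs_nonneg _)))
  · rw [b.push_of_notMem hx, norm_zero]
    positivity

end FlowBox

end Transport

/-! ### Positive functionals and invariance in a flow box -/

section Functional

variable {m : ℕ} {M : Type*} [TopologicalSpace M] [ChartedSpace (EuclideanSpace ℝ (Fin m)) M]
  [IsManifold (𝓡 m) ∞ M] [T2Space M] [SecondCountableTopology M]

variable (m) in
theorem exists_smooth_cutoff {K U : Set M} (hK : IsCompact K) (hU : IsOpen U) (hKU : K ⊆ U) :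
    ∃ χ : M → ℝ, ContMDiff (𝓡 m) 𝓘(ℝ, ℝ) ∞ χ ∧ HasCompactSupport χ ∧ tsupport χ ⊆ U ∧
      (∀ᶠ x in 𝓝ˢ K, χ x = 1) ∧ ∀ x, 0 ≤ χ x := by
  have : LocallyCompactSpace M := ChartedSpace.locallyCompactSpace (EuclideanSpace ℝ (Fin m)) M
  obtain ⟨L, hL, hKL, hLU⟩ := exists_compact_between hK hU hKU
  obtain ⟨χ, h1, h0, hI⟩ := exists_contMDiffMap_one_nhds_of_subset_interior (𝓡 m) (n := ⊤)
    hK.isClosed hKL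
  have hs : tsupport χ ⊆ L :=
    closure_minimal (fun x hx ↦ by_contra fun h ↦ hx (h0 x h)) hL.isClosed
  exact ⟨χ, χ.contMDiff, hL.of_isClosed_subset (isClosed_tsupport _) hs, hs.trans hLU, h1,
    fun x ↦ (hI x).1⟩

/-- A linear functional on test functions which is non-negative on non-negative functions. -/
def IsPositive (φ : testFunctions m M →ₗ[ℂ] ℂ) : Prop :=
  ∀ f : testFunctions m M, (∀ x, 0 ≤ (f : M → ℂ) x) → 0 ≤ φ f

/-- A positive functional has order zero: if `χ` is 1 on `K` and `h` is real with `|h| ≤ a`,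
vanishing off `K`, then `a χ ± h ≥ 0`, so `|φ h| ≤ a φ χ`. Real and imaginary parts together cost
the factor 2. -/
theorem IsPositive.exists_bound {φ : testFunctions m M →ₗ[ℂ] ℂ} (hφ : IsPositive φ) {K : Set M}
    (hK : IsCompact K) : ∃ C ≥ 0, ∀ f : testFunctions m M, (∀ x ∉ K, (f : M → ℂ) x = 0) →
      ∀ a, 0 ≤ a → (∀ x, ‖(f : M → ℂ) x‖ ≤ a) → ‖φ f‖ ≤ C * a := by
  obtain ⟨χ, hχ, hχc, -, hχ1, hχ0⟩ := exists_smooth_cutoff m hK isOpen_univ (subset_univ K)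
  let X : testFunctions m M := ⟨_, ofReal_comp_mem hχ hχc⟩
  have hreal : ∀ (h : M → ℝ) (hh : (fun x ↦ (h x : ℂ)) ∈ testFunctions m M),
      (∀ x ∉ K, h x = 0) → ∀ a : ℝ, 0 ≤ a → (∀ x, |h x| ≤ a) → ‖φ ⟨_, hh⟩‖ ≤ a * (φ X).re := by
    intro h hh h0 a ha hha
    have hle : ∀ x, |h x| ≤ a * χ x := by
      intro x
      by_cases hx : x ∈ K
      · rw [hχ1.self_of_nhdsSet x hx, mul_one]
        exact hha x
      · rw [h0 x hx, abs_zero]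
        exact mul_nonneg ha (hχ0 x)
    have h1 : 0 ≤ φ ((a : ℂ) • X + ⟨_, hh⟩) := hφ _ fun x ↦ by
      change (0 : ℂ) ≤ (a : ℂ) * (χ x : ℂ) + (h x : ℂ)
      exact_mod_cast by linarith [neg_abs_le (h x), hle x]
    have h2 : 0 ≤ φ ((a : ℂ) • X - ⟨_, hh⟩) := hφ _ fun x ↦ by
      change (0 : ℂ) ≤ (a : ℂ) * (χ x : ℂ) - (h x : ℂ)
      exact_mod_cast by linarith [le_abs_self (h x), hle x]
    rw [map_add, map_smul, Complex.le_def] at h1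
    rw [map_sub, map_smul, Complex.le_def] at h2
    simp at h1 h2
    have him : (φ ⟨_, hh⟩).im = 0 := by linarith [h1.2, h2.2]
    rw [← Complex.re_add_im (φ ⟨_, hh⟩), him]
    simp only [Complex.ofReal_zero, zero_mul, add_zero, Complex.norm_real, Real.norm_eq_abs]
    exact abs_le.2 ⟨by linarith, by linarith⟩
  refine ⟨2 * |(φ X).re|, by positivity, fun f hf a ha hfa ↦ ?_⟩
  have hre : (fun x ↦ (((f : M → ℂ) x).re : ℂ)) ∈ testFunctions m M :=
    ofReal_comp_mem (Complex.reCLM.contDiff.contMDiff.comp f.2.1) (f.2.2.comp_left Complex.zero_re)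
  have him : (fun x ↦ (((f : M → ℂ) x).im : ℂ)) ∈ testFunctions m M :=
    ofReal_comp_mem (Complex.imCLM.contDiff.contMDiff.comp f.2.1) (f.2.2.comp_left Complex.zero_im)
  have hsplit : f = ⟨_, hre⟩ + Complex.I • ⟨_, him⟩ := by
    ext x
    change (f : M → ℂ) x = (((f : M → ℂ) x).re : ℂ) + Complex.I * (((f : M → ℂ) x).im : ℂ)
    rw [mul_comm, Complex.re_add_im]
  have b1 := hreal _ hre (fun x hx ↦ by rw [hf x hx]; rfl) a ha
    fun x ↦ (Complex.abs_re_le_norm _).trans (hfa x)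
  have b2 := hreal _ him (fun x hx ↦ by rw [hf x hx]; rfl) a ha
    fun x ↦ (Complex.abs_im_le_norm _).trans (hfa x)
  have b3 : a * (φ X).re ≤ |(φ X).re| * a := by
    rw [mul_comm]
    exact mul_le_mul_of_nonneg_right (le_abs_self _) ha
  rw [hsplit, map_add, map_smul]
  refine (norm_add_le _ _).trans ?_
  rw [norm_smul, Complex.norm_I, one_mul]
  linarith

open Classical in
/-- Extension by zero of a functional on test functions to all functions. -/
def extendFun (φ : testFunctions m M →ₗ[ℂ] ℂ) (f : M → ℂ) : ℂ :=
  if h : f ∈ testFunctions m M then φ ⟨f, h⟩ else 0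

theorem extendFun_of_mem (φ : testFunctions m M →ₗ[ℂ] ℂ) {f : M → ℂ}
    (h : f ∈ testFunctions m M) : extendFun φ f = φ ⟨f, h⟩ := dif_pos h

/-- Used at each point `x` for the time dependence of `push`; the constant is independent of `x`, so
the remainder is small in sup norm. -/
theorem norm_taylor_le {P Q S : ℝ → ℂ} {a b C : ℝ} (hP : ∀ r ∈ Ioo a b, HasDerivAt P (Q r) r)
    (hQ : ∀ r ∈ Ioo a b, HasDerivAt Q (S r) r) (hS : ∀ r ∈ Ioo a b, ‖S r‖ ≤ C) {s r : ℝ}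
    (hs : s ∈ Ioo a b) (hr : r ∈ Ioo a b) :
    ‖P r - P s - ((r - s : ℝ) : ℂ) * Q s‖ ≤ C * |r - s| ^ 2 := by
  have hC : 0 ≤ C := (norm_nonneg _).trans (hS s hs)
  have h1 : ∀ q ∈ uIcc s r, ‖Q q - Q s‖ ≤ C * |r - s| := by
    intro q hq
    have hqI := ordConnected_Ioo.uIcc_subset hs hr hq
    refine ((convex_Ioo a b).norm_image_sub_le_of_norm_hasDerivWithin_le
      (fun x hx ↦ (hQ x hx).hasDerivWithinAt) hS hs hqI).trans ?_
    exact mul_le_mul_of_nonneg_left (abs_sub_left_of_mem_uIcc hq) hC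
  have h2 : ∀ q ∈ uIcc s r, HasDerivWithinAt (fun q ↦ P q - ((q : ℝ) : ℂ) * Q s) (Q q - Q s)
      (uIcc s r) q := by
    intro q hq
    have h3 := (hP q (ordConnected_Ioo.uIcc_subset hs hr hq)).fun_sub
      ((Complex.ofRealCLM.hasDerivAt (x := q)).mul_const (Q s))
    simpa using h3.hasDerivWithinAt
  have h3 := (convex_uIcc s r).norm_image_sub_le_of_norm_hasDerivWithin_le h2 h1
    left_mem_uIcc right_mem_uIcc
  rw [Real.norm_eq_abs] at h3
  calc _ = ‖P r - (r : ℂ) * Q s - (P s - (s : ℂ) * Q s)‖ := by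
        congr 1
        push_cast
        ring
    _ ≤ _ := h3
    _ = _ := by ring

/-- A quadratic increment bound forces the derivative to be zero everywhere on the interval. -/
theorem eqOn_const_of_norm_sub_le_sq {F : ℝ → ℂ} {a b C : ℝ}
    (h : ∀ s ∈ Ioo a b, ∀ r ∈ Ioo a b, ‖F r - F s‖ ≤ C * |r - s| ^ 2) {s r : ℝ}
    (hs : s ∈ Ioo a b) (hr : r ∈ Ioo a b) : F r = F s := by
  have hd : ∀ s ∈ Ioo a b, HasDerivAt F 0 s := by
    intro s hs
    rw [hasDerivAt_iff_isLittleO]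
    simp only [smul_zero, sub_zero]
    have h1 : (fun r ↦ F r - F s) =O[𝓝 s] fun r ↦ |r - s| ^ 2 := by
      refine Asymptotics.IsBigO.of_bound C ?_
      filter_upwards [isOpen_Ioo.mem_nhds hs] with r hr
      rw [norm_pow, Real.norm_eq_abs, abs_abs]
      exact h s hs r hr
    refine h1.trans_isLittleO ?_
    have h2 : Tendsto (fun r : ℝ ↦ r - s) (𝓝 s) (𝓝 0) := by
      have : Continuous fun r : ℝ ↦ r - s := by fun_prop
      simpa using this.tendsto s
    exact (Asymptotics.isLittleO_norm_pow_id (E' := ℝ) one_lt_two).comp_tendsto h2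
  have := (convex_Ioo a b).norm_image_sub_le_of_norm_hasDerivWithin_le (C := 0)
    (fun x hx ↦ (hd x hx).hasDerivWithinAt) (by simp) hs hr
  rw [zero_mul] at this
  exact sub_eq_zero.1 (norm_le_zero_iff.1 this)

variable {V : (x : M) → TangentSpace (𝓡 m) x} {w : M → ℝ}

/-- The functional vanishes on the image of the generator. -/
def VanishesOnGenerator (V : (x : M) → TangentSpace (𝓡 m) x) (w : M → ℝ)
    (φ : testFunctions m M →ₗ[ℂ] ℂ) : Prop :=
  ∀ f ∈ testFunctions m M, ∀ h : generator V w f ∈ testFunctions m M, φ ⟨_, h⟩ = 0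

namespace FlowBox

variable (b : FlowBox V w) {t : ℝ} {f : M → ℂ}

theorem push_zero (hf : tsupport f ⊆ b.small) : b.push 0 f = f := by
  ext x
  by_cases hx : x ∈ b.large
  · simp [b.push_of_mem hx, b.flow_zero x hx]
  · rw [b.push_of_notMem hx, image_eq_zero_of_notMem_tsupport
      fun h ↦ hx (b.small_subset (hf h))]

/-- A positive functional vanishing on the image of the generator is invariant under the weighted
pull-back along a flow box. -/
theorem extendFun_push (hV : IsSmoothField V) (hw : ContMDiff (𝓡 m) 𝓘(ℝ, ℝ) ∞ w)
    {φ : testFunctions m M →ₗ[ℂ] ℂ} (hφ : IsPositive φ) (hφ0 : VanishesOnGenerator V w φ)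
    (hft : f ∈ testFunctions m M) (hf : tsupport f ⊆ b.small) (ht : t ∈ Ioo (-b.ε) b.ε) :
    extendFun φ (b.push t f) = extendFun φ f := by
  have h0 : (0 : ℝ) ∈ Ioo (-b.ε) b.ε := ⟨by linarith [b.ε_pos], b.ε_pos⟩
  have hg := generator_mem (m := m) hV hw hft
  have hgs : tsupport (generator V w f) ⊆ b.small := (tsupport_generator_subset f).trans hf
  have hg2 := generator_mem (m := m) hV hw hg
  obtain ⟨A, hA0, hA⟩ : ∃ A ≥ 0, ∀ x, ‖generator V w (generator V w f) x‖ ≤ A := by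
    obtain ⟨A, hA⟩ := hg2.2.exists_bound_of_continuous hg2.1.continuous
    exact ⟨|A|, abs_nonneg _, fun x ↦ (hA x).trans (le_abs_self _)⟩
  obtain ⟨C, hC0, hC⟩ := hφ.exists_bound b.isCompact_core
  have hA' : ∀ x, ∀ r ∈ Ioo (-b.ε) b.ε, ‖b.push r (generator V w (generator V w f)) x‖ ≤
      Real.exp (|b.bound| * b.ε) * A := fun x r hr ↦ b.norm_push_le hA hr x
  have key : ∀ s ∈ Ioo (-b.ε) b.ε, ∀ r ∈ Ioo (-b.ε) b.ε,
      ‖extendFun φ (b.push r f) - extendFun φ (b.push s f)‖ ≤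
        (C * (Real.exp (|b.bound| * b.ε) * A)) * |r - s| ^ 2 := by
    intro s hs r hr
    have mr := b.push_mem hV hf hft hr
    have ms := b.push_mem hV hf hft hs
    have mg := b.push_mem hV hgs hg hs
    -- The first-order Taylor term is the generator applied to `push s f`, which `φ` kills; only the
    -- quadratic remainder survives.
    have hz : φ ⟨_, mg⟩ = 0 := by
      have h1 : b.push s (generator V w f) = generator V w (b.push s f) :=
        b.push_generator hV hw.continuous hft hf hs
      have h2 := hφ0 _ ms (h1 ▸ mg)
      rw [← h2]
      congr 1
      exact Subtype.ext h1
    have hzero : ∀ {h : M → ℂ}, h ∈ testFunctions m M → tsupport h ⊆ b.small →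
        ∀ {q}, q ∈ Ioo (-b.ε) b.ε → ∀ x ∉ b.core, b.push q h x = 0 :=
      fun h1 h2 _ h3 x hx ↦ image_eq_zero_of_notMem_tsupport
        fun h4 ↦ hx (b.tsupport_push_subset_core hV h2 h1.2 h3 h4)
    have h3 := hC (⟨_, mr⟩ - ⟨_, ms⟩ - ((r - s : ℝ) : ℂ) • ⟨_, mg⟩) (fun x hx ↦ by
      change b.push r f x - b.push s f x - ((r - s : ℝ) : ℂ) * b.push s (generator V w f) x = 0
      rw [hzero hft hf hr x hx, hzero hft hf hs x hx, hzero hg hgs hs x hx]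
      simp) (Real.exp (|b.bound| * b.ε) * A * |r - s| ^ 2) (by positivity)
      (fun x ↦ norm_taylor_le (fun q hq ↦ b.hasDerivAt_push hw.continuous hft.1 hq)
        (fun q hq ↦ b.hasDerivAt_push hw.continuous hg.1 hq) (hA' x) hs hr)
    rw [map_sub, map_sub, map_smul, hz, smul_zero, sub_zero] at h3
    rw [extendFun_of_mem φ mr, extendFun_of_mem φ ms]
    linarith
  have := eqOn_const_of_norm_sub_le_sq key h0 ht
  rwa [b.push_zero hf] at this

end FlowBox

end Functional

/-! ### Chaining flow boxes along trajectories -/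

section Global

variable {m : ℕ} {M : Type*} [TopologicalSpace M] [ChartedSpace (EuclideanSpace ℝ (Fin m)) M]
  {V : (x : M) → TangentSpace (𝓡 m) x} {w : M → ℝ}

theorem isMIntegralCurveOn_union {γ : ℝ → M} {A B : Set ℝ} (hA : IsClosed A) (hB : IsClosed B)
    (h1 : IsMIntegralCurveOn γ V A) (h2 : IsMIntegralCurveOn γ V B) :
    IsMIntegralCurveOn γ V (A ∪ B) := by
  have key : ∀ {S T : Set ℝ} {t : ℝ}, IsClosed T → t ∉ T → S ∈ 𝓝[S ∪ T] t := by
    intro S T t hT ht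
    filter_upwards [self_mem_nhdsWithin, mem_nhdsWithin_of_mem_nhds (hT.isOpen_compl.mem_nhds ht)]
      with r hr hr'
    exact hr.resolve_right hr'
  intro t ht
  by_cases hA' : t ∈ A
  · by_cases hB' : t ∈ B
    · exact (h1 t hA').union (h2 t hB')
    · exact (h1 t hA').mono_of_mem_nhdsWithin (key hB hB')
  · rw [union_comm]
    exact (h2 t (ht.resolve_left hA')).mono_of_mem_nhdsWithin (key hA hA')

theorem isMIntegralCurveOn_congr {γ γ' : ℝ → M} {A : Set ℝ} (h : IsMIntegralCurveOn γ V A)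
    (he : EqOn γ' γ A) : IsMIntegralCurveOn γ' V A := by
  intro t ht
  have := (h t ht).congr_of_eventuallyEq (f₁ := γ') (eventually_mem_nhdsWithin.mono he) (he ht)
  rwa [← he ht] at this

theorem isMIntegralCurveOn_shift {γ : ℝ → M} {s t : ℝ} {A : Set ℝ}
    (h : IsMIntegralCurveOn γ V A) (hA : uIcc s (t + s) ⊆ A) :
    IsMIntegralCurveOn (γ ∘ (· + s)) V (uIcc 0 t) := by
  refine (h.comp_add s).mono fun r hr ↦ hA ?_
  have := mem_image_of_mem (· + s) hr
  rwa [image_add_const_uIcc, zero_add] at this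

theorem exists_integralCurve_concat {γ γ' : ℝ → M} {s s' : ℝ} (hs : s' ∈ uIcc 0 (s + s'))
    (h : IsMIntegralCurveOn γ V (uIcc 0 s')) (h' : IsMIntegralCurveOn γ' V (uIcc 0 s))
    (h0 : γ' 0 = γ s') :
    ∃ η : ℝ → M, IsMIntegralCurveOn η V (uIcc 0 (s + s')) ∧ η 0 = γ 0 := by
  classical
  let η : ℝ → M := fun r ↦ if r ∈ uIcc 0 s' then γ r else γ' (r - s')
  have hshift : IsMIntegralCurveOn (γ' ∘ (· + -s')) V (uIcc s' (s + s')) := by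
    refine (h'.comp_add (-s')).mono fun r hr ↦ ?_
    have := mem_image_of_mem (· + -s') hr
    rw [image_add_const_uIcc] at this
    simpa using this
  have e1 : EqOn η γ (uIcc 0 s') := fun r hr ↦ if_pos hr
  have e2 : EqOn η (γ' ∘ (· + -s')) (uIcc s' (s + s')) := by
    intro r hr
    by_cases hr' : r ∈ uIcc 0 s'
    · have : r = s' := by
        simp only [mem_uIcc] at hs hr hr'
        rcases hs with hs | hs <;> rcases hr with hr | hr <;> rcases hr' with hr' | hr' <;>
          linarith
      subst this
      simp [e1 hr', h0]
    · simp only [η, if_neg hr']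
      rfl
  refine ⟨η, ?_, e1 left_mem_uIcc⟩
  exact (isMIntegralCurveOn_union isClosed_Icc isClosed_Icc (isMIntegralCurveOn_congr h e1)
    (isMIntegralCurveOn_congr hshift e2)).mono uIcc_subset_uIcc_union_uIcc

/-- The condition on `s'` excludes backtracking: a curve up to time `s + s'` must pass through time
`s'`, and two consecutive curves must concatenate. -/
theorem IsTransport.comp (hw : Continuous w) {s s' : ℝ} {f u v : M → ℂ}
    (hs : s' ∈ uIcc 0 (s + s')) (h : IsTransport V w s f u) (h' : IsTransport V w s' u v) :
    IsTransport V w (s + s') f v := by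
  intro x
  have hsub : uIcc 0 s' ⊆ uIcc 0 (s + s') := uIcc_subset_uIcc left_mem_uIcc hs
  have hsub' : uIcc s' (s + s') ⊆ uIcc 0 (s + s') := uIcc_subset_uIcc hs right_mem_uIcc
  constructor
  · intro γ hγ h0
    have hc : ContinuousOn (fun r ↦ w (γ r)) (uIcc 0 (s + s')) := hw.comp_continuousOn hγ.continuousOn
    have hint : (∫ r in (0 : ℝ)..s', w (γ r)) + ∫ r in (0 : ℝ)..s, w ((γ ∘ (· + s')) r) =
        ∫ r in (0 : ℝ)..(s + s'), w (γ r) := by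
      have := intervalIntegral.integral_comp_add_right (a := 0) (b := s) (fun r ↦ w (γ r)) s'
      rw [zero_add] at this
      refine Eq.trans (congrArg _ this) ?_
      exact intervalIntegral.integral_add_adjacent_intervals (hc.mono hsub).intervalIntegrable
        (hc.mono hsub').intervalIntegrable
    rw [(h' x).1 γ (hγ.mono hsub) h0,
      (h (γ s')).1 _ (isMIntegralCurveOn_shift hγ hsub') (by simp), ← mul_assoc,
      ← Complex.ofReal_mul, ← Real.exp_add, hint]
    rfl
  · intro hno
    by_cases hγ : ∃ γ : ℝ → M, IsMIntegralCurveOn γ V (uIcc 0 s') ∧ γ 0 = x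
    · obtain ⟨γ, hγ, h0⟩ := hγ
      rw [(h' x).1 γ hγ h0, (h (γ s')).2, mul_zero]
      rintro ⟨γ', hγ', h0'⟩
      obtain ⟨η, hη, hη0⟩ := exists_integralCurve_concat hs hγ hγ' h0'
      exact hno ⟨η, hη, hη0.trans h0⟩
    · exact (h' x).2 hγ

theorem IsTransport.sum {ι : Type*} (S : Finset ι) {t : ℝ} {f u : ι → M → ℂ}
    (h : ∀ i ∈ S, IsTransport V w t (f i) (u i)) :
    IsTransport V w t (∑ i ∈ S, f i) (∑ i ∈ S, u i) := by
  intro x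
  constructor
  · intro γ hγ h0
    rw [Finset.sum_apply, Finset.sum_apply, Finset.mul_sum]
    exact Finset.sum_congr rfl fun i hi ↦ (h i hi x).1 γ hγ h0
  · intro hno
    rw [Finset.sum_apply]
    exact Finset.sum_eq_zero fun i hi ↦ (h i hi x).2 hno

variable [IsManifold (𝓡 m) ∞ M] [T2Space M] [SecondCountableTopology M]

/-- Test functions supported near `y` have weighted pull-backs for time `t` supported near `z`
with the same value of the functional. -/
def TransportsNear (V : (x : M) → TangentSpace (𝓡 m) x) (w : M → ℝ)
    (φ : testFunctions m M →ₗ[ℂ] ℂ) (t : ℝ) (y z : M) : Prop :=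
  ∀ N ∈ 𝓝 z, ∃ U ∈ 𝓝 y, ∀ f : testFunctions m M, tsupport (f : M → ℂ) ⊆ U →
    ∃ u : testFunctions m M, IsTransport V w t f u ∧ tsupport (u : M → ℂ) ⊆ N ∧ φ u = φ f

variable {φ : testFunctions m M →ₗ[ℂ] ℂ}

theorem TransportsNear.trans (hw : Continuous w) {s s' : ℝ} {x y z : M}
    (h : TransportsNear V w φ s x y) (h' : TransportsNear V w φ s' y z)
    (hs : s' ∈ uIcc 0 (s + s')) : TransportsNear V w φ (s + s') x z := by
  intro N hN
  obtain ⟨U', hU', hf'⟩ := h' N hN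
  obtain ⟨U, hU, hf⟩ := h U' hU'
  refine ⟨U, hU, fun f hfU ↦ ?_⟩
  obtain ⟨u, hu, huU, hφu⟩ := hf f hfU
  obtain ⟨v, hv, hvN, hφv⟩ := hf' u huU
  exact ⟨v, hu.comp hw hs hv, hvN, hφv.trans hφu⟩

/-- Pulling back by time `t` moves supports by the time `-t` flow, so continuity of that map
controls where the new support lies. -/
theorem FlowBox.transportsNear (b : FlowBox V w) (hV : IsSmoothField V)
    (hw : ContMDiff (𝓡 m) 𝓘(ℝ, ℝ) ∞ w) (hφ : IsPositive φ) (hφ0 : VanishesOnGenerator V w φ)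
    {t : ℝ} (ht : t ∈ Ioo (-b.ε) b.ε) {y : M} (hy : y ∈ b.small) :
    TransportsNear V w φ t y (b.flow (-t) y) := by
  intro N hN
  have hc : ContinuousAt (b.flow (-t)) y :=
    (b.contMDiffOn_flow _ (b.neg_mem ht)).continuousOn.continuousAt
      (b.isOpen_large.mem_nhds (b.small_subset hy))
  refine ⟨b.small ∩ b.flow (-t) ⁻¹' N,
    inter_mem (b.isOpen_small.mem_nhds hy) (hc.preimage_mem_nhds hN), fun f hf ↦ ?_⟩
  have hfs := hf.trans inter_subset_left
  have hm := b.push_mem hV hfs f.2 ht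
  refine ⟨⟨_, hm⟩, b.isTransport_push hV hfs ht, ?_, ?_⟩
  · refine (b.tsupport_push_subset hV hfs f.2.2 ht).trans ?_
    rintro _ ⟨z, hz, rfl⟩
    exact (hf hz).2
  · have := b.extendFun_push hV hw hφ hφ0 f.2 hfs ht
    rwa [extendFun_of_mem φ hm, extendFun_of_mem φ f.2] at this

theorem mem_uIcc_mul {c d t : ℝ} (hc : 0 ≤ c) (hcd : c ≤ d) : c * t ∈ uIcc 0 (d * t) := by
  rw [mem_uIcc]
  rcases le_total 0 t with ht | ht
  · exact Or.inl ⟨mul_nonneg hc ht, mul_le_mul_of_nonneg_right hcd ht⟩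
  · exact Or.inr ⟨mul_le_mul_of_nonpos_right hcd ht, mul_nonpos_of_nonneg_of_nonpos hc ht⟩

/-- The trajectory is compact, so finitely many flow boxes cover it. Control of supports in
`TransportsNear` keeps each intermediate function inside the next box. -/
theorem transportsNear_of_flowsTo (hV : IsSmoothField V) (hw : ContMDiff (𝓡 m) 𝓘(ℝ, ℝ) ∞ w)
    (hφ : IsPositive φ) (hφ0 : VanishesOnGenerator V w φ) {t : ℝ} {y z : M}
    (h : FlowsTo V (-t) y z) : TransportsNear V w φ t y z := by
  obtain ⟨γ, hγ, rfl, rfl⟩ := h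
  let c : Icc (0 : ℝ) 1 → M := fun a ↦ γ (a * -t)
  have hmem : ∀ a : Icc (0 : ℝ) 1, (a : ℝ) * -t ∈ uIcc 0 (-t) := fun a ↦ by
    simpa using mem_uIcc_mul (t := -t) a.2.1 a.2.2
  have hc : Continuous c := by
    refine hγ.continuousOn.comp_continuous (by fun_prop) hmem
  choose b hb using fun a ↦ hV.exists_flowBox hw (c a)
  -- The bound `ε / 2` ensures that two parameters in one `O a` differ in time by less than that
  -- box's `ε`.
  let O : Icc (0 : ℝ) 1 → Set (Icc (0 : ℝ) 1) := fun a ↦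
    c ⁻¹' (b a).small ∩ {a' | |((a' : ℝ) - a) * t| < (b a).ε / 2}
  have hO : ∀ a, IsOpen (O a) := fun a ↦ ((b a).isOpen_small.preimage hc).inter
    (isOpen_lt (by fun_prop) continuous_const)
  have hcov : univ ⊆ ⋃ a, O a := fun a _ ↦
    mem_iUnion.2 ⟨a, hb a, by simpa using half_pos (b a).ε_pos⟩
  have hloc : ∀ i, ∀ a ∈ O i, ∀ a' ∈ O i, a ≤ a' →
      TransportsNear V w φ (((a' : ℝ) - a) * t) (c a) (c a') := by
    intro i a ha a' ha' hle
    have hlt : |((a' : ℝ) - a) * t| < (b i).ε := by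
      have h1 := ha.2
      have h2 := ha'.2
      simp only [mem_ofPred_eq] at h1 h2
      have h3 : ((a' : ℝ) - a) * t = ((a' : ℝ) - i) * t - ((a : ℝ) - i) * t := by ring
      rw [h3]
      exact (abs_sub _ _).trans_lt (by linarith)
    have hm : ((a' : ℝ) - a) * t ∈ Ioo (-(b i).ε) (b i).ε := abs_lt.1 hlt
    have h4 := (b i).transportsNear hV hw hφ hφ0 hm ha.1
    have hshift : IsMIntegralCurveOn (γ ∘ (· + (a : ℝ) * -t)) V
        (uIcc 0 (-(((a' : ℝ) - a) * t))) := by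
      refine isMIntegralCurveOn_shift hγ ?_
      refine uIcc_subset_uIcc (hmem a) ?_
      rw [show -(((a' : ℝ) - a) * t) + a * -t = a' * -t by ring]
      exact hmem a'
    have h5 := (b i).eqOn_flow hV ((b i).neg_mem hm) ((b i).small_subset ha.1) hshift
      (by simp [c]) right_mem_uIcc
    have h6 : (γ ∘ (· + (a : ℝ) * -t)) (-(((a' : ℝ) - a) * t)) = c a' := by
      simp only [Function.comp_apply, c]
      congr 1
      ring
    have h7 : (b i).flow (-(((a' : ℝ) - a) * t)) (c a) = c a' := h5.symm.trans h6
    rwa [h7] at h4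
  obtain ⟨τ, hτ0, hτm, ⟨n, hn⟩, hτ⟩ := exists_monotone_Icc_subset_open_cover_unitInterval hO hcov
  have hind : ∀ k, TransportsNear V w φ ((τ k : ℝ) * t) (c 0) (c (τ k)) := by
    intro k
    induction k with
    | zero =>
      obtain ⟨i, hi⟩ := mem_iUnion.1 (hcov (mem_univ 0))
      have := hloc i 0 hi 0 hi le_rfl
      rw [hτ0]
      simpa using this
    | succ k ih =>
      obtain ⟨i, hi⟩ := hτ k
      have hle := hτm k.le_succ
      have h1 := hloc i _ (hi ⟨le_rfl, hle⟩) _ (hi ⟨hle, le_rfl⟩) hle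
      have h2 : (τ k : ℝ) * t + ((τ (k + 1) : ℝ) - τ k) * t = τ (k + 1) * t := by ring
      have h3 := ih.trans hw.continuous h1 (by
        rw [h2]
        exact mem_uIcc_mul (sub_nonneg.2 hle) (sub_le_self _ (τ k).2.1))
      rwa [h2] at h3
  have := hind n
  rw [hn n le_rfl] at this
  simpa [c] using this

/-- A positive functional vanishing on the image of the generator is invariant under weighted
pull-backs along the flow. -/
theorem exists_transport (hV : IsSmoothField V) (hw : ContMDiff (𝓡 m) 𝓘(ℝ, ℝ) ∞ w)
    (hφ : IsPositive φ) (hφ0 : VanishesOnGenerator V w φ) {t : ℝ} (f : testFunctions m M)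
    (hf : tsupport (f : M → ℂ) ⊆ flowDomain V (-t)) :
    ∃ u : testFunctions m M, IsTransport V w t f u ∧ φ u = φ f := by
  have : LocallyCompactSpace M := ChartedSpace.locallyCompactSpace (EuclideanSpace ℝ (Fin m)) M
  have hloc : ∀ y ∈ tsupport (f : M → ℂ), ∃ U, IsOpen U ∧ y ∈ U ∧ ∀ g : testFunctions m M,
      tsupport (g : M → ℂ) ⊆ U → ∃ u : testFunctions m M, IsTransport V w t g u ∧ φ u = φ g := by
    intro y hy
    obtain ⟨z, hz⟩ := hf hy
    obtain ⟨U, hU, h⟩ := transportsNear_of_flowsTo hV hw hφ hφ0 hz univ univ_mem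
    obtain ⟨U', hU', ho, hyU⟩ := mem_nhds_iff.1 hU
    refine ⟨U', ho, hyU, fun g hg ↦ ?_⟩
    obtain ⟨u, h1, -, h2⟩ := h g (hg.trans hU')
    exact ⟨u, h1, h2⟩
  choose! U hUo hyU hU using hloc
  obtain ⟨T, hT, hcov⟩ := f.2.2.elim_nhds_subcover U fun y hy ↦ (hUo y hy).mem_nhds (hyU y hy)
  -- Transport is linear in `f`, so it suffices to treat pieces subordinate to the finite cover of
  -- the support.
  obtain ⟨ρ, hρ⟩ := SmoothPartitionOfUnity.exists_isSubordinate (𝓡 m)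
    (isClosed_tsupport (f : M → ℂ)) (fun i : T ↦ U i) (fun i ↦ hUo i (hT i i.2))
    (hcov.trans (by simp [iUnion_subtype]))
  have hg : ∀ i, (fun x ↦ (ρ i x : ℂ) * (f : M → ℂ) x) ∈ testFunctions m M := fun i ↦
    ⟨contMDiff_mulC (Complex.ofRealCLM.contDiff.contMDiff.comp (ρ i).contMDiff) f.2.1,
      f.2.2.mul_left⟩
  let g : T → testFunctions m M := fun i ↦ ⟨_, hg i⟩
  have hgs : ∀ i, tsupport (g i : M → ℂ) ⊆ U i := fun i ↦ by
    refine (closure_mono fun x hx ↦ ?_).trans (hρ i)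
    exact fun h ↦ hx (by simp [g, h])
  choose u hu hφu using fun i : T ↦ hU i (hT i i.2) (g i) (hgs i)
  have hsum : f = ∑ i, g i := by
    ext x
    have h1 : ((∑ i, g i : testFunctions m M) : M → ℂ) x = ∑ i, (ρ i x : ℂ) * (f : M → ℂ) x := by
      rw [Submodule.coe_sum, Finset.sum_apply]
    rw [h1, ← Finset.sum_mul, ← Complex.ofReal_sum]
    by_cases hx : x ∈ tsupport (f : M → ℂ)
    · have := ρ.sum_eq_one hx
      rw [finsum_eq_sum_of_fintype] at this
      rw [this, Complex.ofReal_one, one_mul]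
    · rw [image_eq_zero_of_notMem_tsupport hx, mul_zero]
  refine ⟨∑ i, u i, ?_, ?_⟩
  · have := IsTransport.sum Finset.univ fun i _ ↦ hu i
    rw [hsum, Submodule.coe_sum, Submodule.coe_sum]
    exact this
  · conv_rhs => rw [hsum]
    rw [map_sum, map_sum]
    exact Finset.sum_congr rfl fun i _ ↦ hφu i

end Global

/-! ### Consequences of the KMS condition -/

section Poisson

variable {m : ℕ} {M : Type*} [TopologicalSpace M] [ChartedSpace (EuclideanSpace ℝ (Fin m)) M]

theorem differential_congr {f g : M → ℝ} {x : M} (h : f =ᶠ[𝓝 x] g) :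
    differential (m := m) f x = differential g x := by
  unfold differential mvfderiv
  rw [h.mfderiv_eq, h.eq_of_nhds]

theorem differential_const (c : ℝ) (x : M) : differential (m := m) (fun _ : M ↦ c) x = 0 := by
  simp [differential, mvfderiv_const]

theorem differential_eq_zero_of_notMem_tsupport {f : M → ℝ} {x : M} (h : x ∉ tsupport f) :
    differential (m := m) f x = 0 := by
  rw [differential_congr (notMem_tsupport_iff_eventuallyEq.mp h)]
  exact differential_const 0 x

theorem derivAlong_ofReal_mul {V : (x : M) → TangentSpace (𝓡 m) x} {a : M → ℝ} {f : M → ℂ} {x : M}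
    (ha : MDifferentiableAt (𝓡 m) 𝓘(ℝ, ℝ) a x) (hf : MDifferentiableAt (𝓡 m) 𝓘(ℝ, ℂ) f x) :
    derivAlong V (fun y ↦ (a y : ℂ) * f y) x =
      (a x : ℂ) * derivAlong V f x + ((derivAlong V a x : ℝ) : ℂ) * f x := by
  have h1 : (fun y ↦ (a y : ℂ) * f y) = a • f := by
    ext y
    simp
  rw [h1]
  unfold derivAlong
  rw [mvfderiv_smul ha hf]
  simp

namespace PoissonStructure

variable (P : PoissonStructure m M)

theorem isSmoothField_hamiltonianVF {g : M → ℝ} (hg : ContMDiff (𝓡 m) 𝓘(ℝ, ℝ) ∞ g) :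
    IsSmoothField (P.hamiltonianVF g) := by
  intro h hh
  have : derivAlong (P.hamiltonianVF g) h = P.bracket h g :=
    funext fun x ↦ P.derivAlong_hamiltonianVF h g x
  rw [this]
  exact P.smooth h g hh hg

theorem bracketC_ofReal (f : M → ℂ) (g : M → ℝ) (x : M) :
    P.bracketC f (fun y ↦ (g y : ℂ)) x =
      (P.bracket (fun y ↦ (f y).re) g x : ℂ) +
        (P.bracket (fun y ↦ (f y).im) g x : ℂ) * Complex.I := by
  have h0 : ∀ h : M → ℝ, P.bracket h (fun _ ↦ 0) x = 0 := fun h ↦ by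
    simp [bracket, differential_const]
  simp [bracketC, h0]

theorem derivAlong_hamiltonianVF_complex {f : M → ℂ} (hf : ContMDiff (𝓡 m) 𝓘(ℝ, ℂ) ∞ f)
    (g : M → ℝ) (x : M) :
    derivAlong (P.hamiltonianVF g) f x = P.bracketC f (fun y ↦ (g y : ℂ)) x := by
  have hd : MDifferentiableAt (𝓡 m) 𝓘(ℝ, ℂ) f x := hf.mdifferentiable (by simp) x
  have h1 := derivAlong_clm_comp (V := P.hamiltonianVF g) Complex.reCLM hd
  have h2 := derivAlong_clm_comp (V := P.hamiltonianVF g) Complex.imCLM hd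
  rw [P.derivAlong_hamiltonianVF] at h1 h2
  rw [bracketC_ofReal, ← Complex.re_add_im (derivAlong (P.hamiltonianVF g) f x)]
  exact congrArg₂ (fun a b : ℝ ↦ (a : ℂ) + (b : ℂ) * Complex.I) h1.symm h2.symm

/-- Off `tsupport f` both brackets vanish; on it only the germ of the second argument matters. This
permits cutting off a non-compactly supported Hamiltonian. -/
theorem bracketC_congr_right {f : M → ℂ} {g h : M → ℝ}
    (hgh : ∀ x ∈ tsupport f, g =ᶠ[𝓝 x] h) :
    P.bracketC f (fun y ↦ (g y : ℂ)) = P.bracketC f (fun y ↦ (h y : ℂ)) := by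
  ext x
  rw [bracketC_ofReal, bracketC_ofReal]
  by_cases hx : x ∈ tsupport f
  · simp only [bracket, differential_congr (hgh x hx)]
  · have h1 : differential (m := m) (fun y ↦ (f y).re) x = 0 :=
      differential_eq_zero_of_notMem_tsupport fun h ↦ hx
        (tsupport_comp_subset Complex.zero_re f h)
    have h2 : differential (m := m) (fun y ↦ (f y).im) x = 0 :=
      differential_eq_zero_of_notMem_tsupport fun h ↦ hx
        (tsupport_comp_subset Complex.zero_im f h)
    simp [bracket, h1, h2]

end PoissonStructure

theorem isSmoothField_section [IsManifold (𝓡 m) ∞ M] (X : VectorField m M) : IsSmoothField (fun x ↦ X x) :=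
  fun _ hh ↦ contMDiff_derivAlong X hh

theorem derivAlong_mem [IsManifold (𝓡 m) ∞ M] (X : VectorField m M) {f : M → ℂ} (hf : f ∈ testFunctions m M) :
    derivAlong X f ∈ testFunctions m M :=
  ⟨contMDiff_derivAlong X hf.1,
    hf.2.of_isClosed_subset (isClosed_tsupport _) (tsupport_derivAlong_subset f)⟩

variable [IsManifold (𝓡 m) ∞ M] [T2Space M] [SecondCountableTopology M]
  {P : PoissonStructure m M} {X : VectorField m M} {β : ℝ} {φ : testFunctions m M →ₗ[ℂ] ℂ}

/-- With a cutoff `χ` equal to 1 near the support of `f`, `{f, χ} = 0` and `χ X(f) = X(f)`, so the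
KMS condition reads `0 = β φ(X f)`. -/
theorem IsKMSFunctional.apply_derivAlong (hφ : IsKMSFunctional P X β φ) (hβ : β ≠ 0) {f : M → ℂ}
    (hf : f ∈ testFunctions m M) (h : derivAlong X f ∈ testFunctions m M) : φ ⟨_, h⟩ = 0 := by
  obtain ⟨χ, hχ, hχc, -, hχ1, -⟩ :=
    exists_smooth_cutoff m (K := tsupport f) hf.2 isOpen_univ (subset_univ _)
  have hχ1' : ∀ x ∈ tsupport f, χ =ᶠ[𝓝 x] fun _ ↦ 1 :=
    fun x hx ↦ eventually_nhdsSet_iff_forall.1 hχ1 x hx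
  have h1 := hφ.kms ⟨f, hf⟩ ⟨_, ofReal_comp_mem hχ hχc⟩
  have h2 : P.bracketC f (fun x ↦ (χ x : ℂ)) = 0 := by
    rw [P.bracketC_congr_right hχ1']
    ext x
    rw [P.bracketC_ofReal]
    simp [PoissonStructure.bracket, differential_const]
  have h3 : (fun x ↦ (χ x : ℂ) * derivAlong X f x) = derivAlong X f := by
    ext x
    by_cases hx : x ∈ tsupport f
    · rw [(hχ1' x hx).eq_of_nhds, Complex.ofReal_one, one_mul]
    · rw [derivAlong_eq_zero_of_notMem_tsupport hx, mul_zero]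
  have h4 : (⟨P.bracketC f (fun x ↦ (χ x : ℂ)), bracketC_mem P hf (ofReal_comp_mem hχ hχc)⟩ :
      testFunctions m M) = 0 := Subtype.ext h2
  have h5 : (⟨fun x ↦ (χ x : ℂ) * derivAlong X f x,
      mul_derivAlong_mem X hf (ofReal_comp_mem hχ hχc)⟩ : testFunctions m M) = ⟨_, h⟩ :=
    Subtype.ext h3
  rw [h4, h5, map_zero] at h1
  exact (mul_eq_zero.1 h1.symm).resolve_left (Complex.ofReal_ne_zero.2 hβ)

theorem IsKMSFunctional.vanishesOnGenerator_field (hφ : IsKMSFunctional P X β φ) (hβ : β ≠ 0) :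
    VanishesOnGenerator (fun x ↦ X x) (fun _ ↦ 0) φ := by
  intro f hf h
  have h1 : generator (fun x ↦ X x) (fun _ ↦ 0) f = derivAlong X f := by
    ext x
    simp [generator]
  have h2 := hφ.apply_derivAlong hβ hf (derivAlong_mem X hf)
  rw [← h2]
  congr 1
  exact Subtype.ext h1

theorem IsKMSFunctional.vanishesOnGenerator_hamiltonian (hφ : IsKMSFunctional P X β φ)
    (hβ : β ≠ 0) {g : M → ℝ} (hg : ContMDiff (𝓡 m) 𝓘(ℝ, ℝ) ∞ g) :
    VanishesOnGenerator (P.hamiltonianVF g) (fun x ↦ β * derivAlong X g x) φ := by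
  intro f hf h
  obtain ⟨χ, hχ, hχc, -, hχ1, -⟩ :=
    exists_smooth_cutoff m (K := tsupport f) hf.2 isOpen_univ (subset_univ _)
  let G : M → ℝ := fun x ↦ χ x * g x
  have hG : ContMDiff (𝓡 m) 𝓘(ℝ, ℝ) ∞ G := hχ.mul hg
  have hGm := ofReal_comp_mem (m := m) hG hχc.mul_right
  have hGg : ∀ x ∈ tsupport f, G =ᶠ[𝓝 x] g := fun x hx ↦ by
    filter_upwards [eventually_nhdsSet_iff_forall.1 hχ1 x hx] with y hy
    simp [G, hy]
  have hGf : (fun x ↦ (G x : ℂ) * f x) ∈ testFunctions m M :=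
    ⟨contMDiff_mulC hGm.1 hf.1, hf.2.mul_left⟩
  have h1 := hφ.kms ⟨f, hf⟩ ⟨_, hGm⟩
  have h2 := hφ.apply_derivAlong hβ hGf (derivAlong_mem X hGf)
  -- Leibniz for `X (G f)`, with `G` equal to `g` near the support of `f`. Under `φ` the bracket
  -- cancels the last term by KMS, and the middle term vanishes by invariance under `X`.
  have h3 : (⟨_, h⟩ : testFunctions m M) = ⟨_, bracketC_mem P hf hGm⟩ +
      (β : ℂ) • ⟨_, derivAlong_mem X hGf⟩ - (β : ℂ) • ⟨_, mul_derivAlong_mem X hf hGm⟩ := by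
    ext x
    change derivAlong (P.hamiltonianVF g) f x + ((β * derivAlong X g x : ℝ) : ℂ) * f x =
      P.bracketC f (fun x ↦ (G x : ℂ)) x + (β : ℂ) * derivAlong X (fun x ↦ (G x : ℂ) * f x) x -
        (β : ℂ) * ((G x : ℂ) * derivAlong X f x)
    rw [P.derivAlong_hamiltonianVF_complex hf.1, P.bracketC_congr_right hGg,
      derivAlong_ofReal_mul (hG.mdifferentiable (by simp) x) (hf.1.mdifferentiable (by simp) x)]
    have h4 : ((derivAlong X G x : ℝ) : ℂ) * f x = ((derivAlong X g x : ℝ) : ℂ) * f x := by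
      by_cases hx : x ∈ tsupport f
      · rw [derivAlong_congr (hGg x hx)]
      · rw [image_eq_zero_of_notMem_tsupport hx, mul_zero, mul_zero]
    rw [h4]
    push_cast
    ring
  rw [h3, map_sub, map_add, map_smul, map_smul, h1, h2]
  simp

/-- Cutting off the local Hamiltonian near the compact trajectory makes it global without changing
the curve. The transported test function stays non-negative, keeps its value under `φ`, and is
supported near the end point. -/
theorem IsKMSFunctional.hamiltonianStep (hφ : IsKMSFunctional P X β φ) (hβ : β ≠ 0) {x y : M}
    (hx : x ∈ funSupport φ) (hxy : HamiltonianStep P x y) : y ∈ funSupport φ := by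
  obtain ⟨U, g, γ, t, hU, hg, hγU, hγ, rfl, rfl⟩ := hxy
  obtain ⟨χ, hχ, -, hχU, hχ1, -⟩ := exists_smooth_cutoff m
    (isCompact_uIcc.image_of_continuousOn hγ.continuousOn) hU (image_subset_iff.2 hγU)
  let G : M → ℝ := fun x ↦ χ x * g x
  have hG : ContMDiff (𝓡 m) 𝓘(ℝ, ℝ) ∞ G := by
    intro z
    by_cases hz : z ∈ U
    · exact hχ.contMDiffAt.mul (hg.contMDiffAt (hU.mem_nhds hz))
    · refine (contMDiffAt_const (c := (0 : ℝ))).congr_of_eventuallyEq ?_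
      filter_upwards [notMem_tsupport_iff_eventuallyEq.mp fun h ↦ hz (hχU h)] with y hy
      simp [G, hy]
  have hγG : IsMIntegralCurveOn γ (P.hamiltonianVF G) (uIcc 0 t) := by
    intro s hs
    have h1 : G =ᶠ[𝓝 (γ s)] g := by
      filter_upwards [eventually_nhdsSet_iff_forall.1 hχ1 _ (mem_image_of_mem γ hs)] with y hy
      simp [G, hy]
    have h2 : P.hamiltonianVF G (γ s) = P.hamiltonianVF g (γ s) := by
      rw [PoissonStructure.hamiltonianVF, differential_congr h1, PoissonStructure.hamiltonianVF]
    rw [h2]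
    exact hγ s hs
  have hw : ContMDiff (𝓡 m) 𝓘(ℝ, ℝ) ∞ (fun x ↦ β * derivAlong X G x) :=
    contMDiff_const.mul (contMDiff_derivAlong X hG)
  -- Pull-back moves supports against the flow, so reaching `γ t` from `γ 0` takes time `-t`.
  have hnear := transportsNear_of_flowsTo (t := -t) (P.isSmoothField_hamiltonianVF hG) hw
    hφ.positive (hφ.vanishesOnGenerator_hamiltonian hβ hG)
    ⟨γ, by rwa [neg_neg], rfl, by rw [neg_neg]⟩
  intro N hN hyN
  obtain ⟨W, hW, h⟩ := hnear N (hN.mem_nhds hyN)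
  obtain ⟨W', hW', hWo, hxW⟩ := mem_nhds_iff.1 hW
  obtain ⟨f, hfW, hf0, hφf⟩ := hx W' hWo hxW
  obtain ⟨u, hu, huN, hφu⟩ := h f (hfW.trans hW')
  refine ⟨u, huN, fun z ↦ ?_, by rwa [hφu]⟩
  by_cases hz : ∃ η : ℝ → M, IsMIntegralCurveOn η (P.hamiltonianVF G) (uIcc 0 (-t)) ∧ η 0 = z
  · obtain ⟨η, hη, h0⟩ := hz
    rw [(hu z).1 η hη h0]
    exact mul_nonneg (Complex.zero_le_real.2 (Real.exp_pos _).le) (hf0 _)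
  · rw [(hu z).2 hz]

end Poisson

end KMS

end

theorem mainTheorem6 {m : ℕ} {M : Type*} [TopologicalSpace M] [T2Space M]
    [SecondCountableTopology M] [ChartedSpace (EuclideanSpace ℝ (Fin m)) M]
    [IsManifold (𝓡 m) ∞ M] (P : KMS.PoissonStructure m M) (X : KMS.VectorField m M)
    (β : ℝ) (hβ : 0 < β) (φ : KMS.testFunctions m M →ₗ[ℂ] ℂ)
    (hφ : KMS.IsKMSFunctional P X β φ) :
    -- invariance under the (local) flow of `X`
    (∀ (t : ℝ) (f : KMS.testFunctions m M),
      tsupport (f : M → ℂ) ⊆ KMS.flowDomain X (-t) →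
      ∃ h : KMS.flowPullback X t f ∈ KMS.testFunctions m M, φ ⟨_, h⟩ = φ f) ∧
    -- global KMS condition
    (∀ g : M → ℝ, ContMDiff (𝓡 m) 𝓘(ℝ, ℝ) ∞ g →
      ∀ Ψ : ℝ → M → M, KMS.IsGlobalFlow (P.hamiltonianVF g) Ψ →
      ∀ (t : ℝ) (f : KMS.testFunctions m M),
      ∃ h : (fun x ↦ (Real.exp (β * ∫ s in (0 : ℝ)..t, KMS.derivAlong X g (Ψ s x)) : ℂ) *
          (f : M → ℂ) (Ψ t x)) ∈ KMS.testFunctions m M,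
        φ f = φ ⟨_, h⟩) ∧
    -- support and symplectic leaves
    (CompactSpace M →
      (∀ x ∈ KMS.funSupport φ, KMS.symplecticLeaf P x ⊆ KMS.funSupport φ) ∧
      KMS.funSupport φ = ⋃ x ∈ KMS.funSupport φ, KMS.symplecticLeaf P x) := by
  refine ⟨fun t f hf ↦ ?_, fun g hg Ψ hΨ t f ↦ ?_, fun _ ↦ ?_⟩
  · obtain ⟨u, hu, hφu⟩ := KMS.exists_transport (KMS.isSmoothField_section X) contMDiff_const
      hφ.positive (hφ.vanishesOnGenerator_field hβ.ne') f hf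
    have hpull : KMS.flowPullback X t f = u := by
      ext x
      unfold KMS.flowPullback
      split_ifs with h
      -- `IsTransport` fixes `u x` through every integral curve from `x`, so the arbitrary choice in
      -- `flowPullback` is harmless.
      · obtain ⟨γ, hγ, h0, h1⟩ := h.choose_spec
        rw [(hu x).1 γ hγ h0, h1]
        simp
      · refine ((hu x).2 ?_).symm
        rintro ⟨γ, hγ, h0⟩
        exact h ⟨_, γ, hγ, h0, rfl⟩
    rw [← hφu]
    exact ⟨hpull ▸ u.2, congrArg φ (Subtype.ext hpull)⟩
  · have hw : ContMDiff (𝓡 m) 𝓘(ℝ, ℝ) ∞ (fun x ↦ β * KMS.derivAlong X g x) :=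
      contMDiff_const.mul (KMS.contMDiff_derivAlong X hg)
    have hcurve : ∀ x t, IsMIntegralCurveOn (fun s ↦ Ψ s x) (P.hamiltonianVF g) (Set.uIcc 0 t) :=
      fun x t ↦ (hΨ x).2.isMIntegralCurveOn _
    obtain ⟨u, hu, hφu⟩ := KMS.exists_transport (P.isSmoothField_hamiltonianVF hg) hw
      hφ.positive (hφ.vanishesOnGenerator_hamiltonian hβ.ne' hg) (t := t) f
      fun x _ ↦ ⟨_, _, hcurve x (-t), (hΨ x).1, rfl⟩
    have hpull : (fun x ↦ (Real.exp (β * ∫ s in (0 : ℝ)..t, KMS.derivAlong X g (Ψ s x)) : ℂ) *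
        (f : M → ℂ) (Ψ t x)) = u := by
      ext x
      rw [(hu x).1 _ (hcurve x t) (hΨ x).1, intervalIntegral.integral_const_mul]
    rw [← hφu]
    exact ⟨hpull ▸ u.2, congrArg φ (Subtype.ext hpull.symm)⟩
  · have hleaf : ∀ x ∈ KMS.funSupport φ, KMS.symplecticLeaf P x ⊆ KMS.funSupport φ := by
      intro x hx y hy
      induction hy with
      | refl => exact hx
      | tail _ hstep ih => exact hφ.hamiltonianStep hβ.ne' ih hstep
    refine ⟨hleaf, Set.Subset.antisymm (fun x hx ↦ ?_) (Set.iUnion₂_subset hleaf)⟩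
    exact Set.mem_iUnion₂.2 ⟨x, hx, Relation.ReflTransGen.refl⟩
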